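/- Let $\{x(n)\}_{n\in\mathbb{Z}}$ be a complex second-order random process ($E|x(n)|^2<\infty$) with autocorrelation $r_x(n,m)=E[x(n+m)x^*(n)]$, cyclostationary with period $P\ge 1$, i.e. $r_x(n+lP,m)=r_x(n,m)$ for all $l,n,m\in\mathbb{Z}$, and suppose $\sum_{m}|r_x(n,m)|<\infty$ for each $n$. Let $$S_X^{(k/P)}(f)=\frac1P\sum_{n=0}^{P-1}\sum_{m\in\mathbb{Z}} r_x(n,m)\,e^{-j2\pi(kn/P+fm)}\qquad(k\in\mathbb{Z},\ f\in\mathbb{R})$$ be its cyclic spectrum, and let the cyclic PSD matrix $\mathbf{S}_X(\sigma)\in\mathbb{C}^{P\times P}$, $\sigma\in[0,1/P)$, have entries $[\mathbf{S}_X(\sigma)]_{r,c}=S_X^{((r-c)/P)}(\sigma+\tfrac rP)$, $0\le r,c\le P-1$. Let $\phi(n,\lambda)$, $n\in\mathbb{Z}$, $\lambda\in[0,1)$, measurable in $\lambda$, be a Karhunen–Loève (KL) basis of the process with KL spectrum $\mathcal{S}(\lambda)$, that is: $\int_0^1\phi(n,\lambda)\phi^*(n',\lambda)\,d\lambda=\delta_{n-n'}$;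 $\sum_n\phi(n,\lambda)\phi^*(n,\lambda')=\delta(\lambda-\lambda')$ in the weak sense (when integrated over $A\times B$, for all measurable $A,B\subseteq[0,1)$); and $\sum_{l\in\mathbb{Z}} r_x(l,k-l)\phi(l,\lambda)=\mathcal{S}(\lambda)\phi(k,\lambda)$ for all $k\in\mathbb{Z}$ and $\lambda\in[0,1)$. Suppose it has the form proper to cyclostationary processes, $\phi(n,\sigma+\tfrac pP)=\sum_{q=0}^{P-1}b^{(p)}(q,\sigma)e^{j2\pi(\sigma+q/P)n}$ for $\sigma\in[0,1/P)$ and $0\le p\le P-1$. Write $\mathcal{S}^{(p)}(\sigma)=\mathcal{S}(\sigma+\tfrac pP)$. For measurable $A\subseteq[0,1)$ let $\xi(A)=\int_A d\xi(\lambda)$ be the mean-square limit of $\sum_{n=-M}^{M-1}x(n)\int_A\phi^*(n,\lambda)\,d\lambda$ as $M\to\infty$, and for measurable $A\subseteq[0,1/P)$ let $\widetilde{\mathbf{x}}(A)=[\xi(A),\xi(A+\tfrac1P),\dots,\xi(A+\tfrac{P-1}P)]^T$. Then: 1. The limits $\xi(A)$ exist, the functions $\mathcal{S}^{(p)}$ are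 integrable on $[0,1/P)$, and $E[\widetilde{\mathbf{x}}(\sigma)\widetilde{\mathbf{x}}^H(\sigma)]=\mathrm{Diag}(\mathcal{S}^{(0)}(\sigma),\dots,\mathcal{S}^{(P-1)}(\sigma))\,d\sigma$, in the sense that for all measurable $A,B\subseteq[0,1/P)$ $$E[\widetilde{\mathbf{x}}(A)\widetilde{\mathbf{x}}(B)^H]=\int_{A\cap B}\mathrm{Diag}\bigl(\mathcal{S}^{(0)}(\sigma),\dots,\mathcal{S}^{(P-1)}(\sigma)\bigr)\,d\sigma .$$ 2. The matrix $\mathbf{B}(\sigma)$ with columns $\mathbf{b}^{(p)}(\sigma)=[b^{(p)}(0,\sigma),\dots,b^{(p)}(P-1,\sigma)]^T$ is unitary for almost every $\sigma\in[0,1/P)$, and at every $\sigma\in[0,1/P)$ where it is unitary, $\mathcal{S}^{(0)}(\sigma),\dots,\mathcal{S}^{(P-1)}(\sigma)$ are the $P$ eigenvalues of $\mathbf{S}_X(\sigma)$, counted with multiplicity. 3. The average power $\lim_{N\to\infty}\frac1N\sum_{n=-N/2}^{N/2-1}E|x(n)|^2$ ($N$ even) exists and equals $$\int_0^{1/P}\mathrm{tr}\,\mathrm{Diag}\bigl(\mathcal{S}^{(0)}(\sigma),\dots,\mathcal{S}^{(P-1)}(\sigma)\bigr)\,d\sigma=\int_0^{1/P}\mathrm{tr}\,\mathbf{S}_X(\sigma)\,d\sigma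 .$$ The equality with $\int_0^{1/P}\mathrm{tr}\,\mathbf{S}_X(\sigma)\,d\sigma$ (where $\mathrm{tr}\,\mathbf{S}_X$ is integrable) needs no KL basis. -/

import Mathlib

open MeasureTheory Filter Topology Set
open scoped ComplexConjugate

/-- Autocorrelation `E[x(n+m) x*(n)]` at time `n` and lag `m`. -/
noncomputable def autocorr {Ω : Type*} [MeasurableSpace Ω] (μ : Measure Ω)
    (x : ℤ → Ω → ℂ) (n m : ℤ) : ℂ :=
  ∫ ω, x (n + m) ω * conj (x n ω) ∂μ

/-- The autocorrelation is periodic in time with period `P`. -/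
def IsCyclostationary {Ω : Type*} [MeasurableSpace Ω] (μ : Measure Ω)
    (x : ℤ → Ω → ℂ) (P : ℕ) : Prop :=
  ∀ n m l : ℤ, autocorr μ x n m = autocorr μ x (n + l * P) m

/-- Cyclic spectrum at cycle frequency `k / P` and frequency `f`. -/
noncomputable def cyclicSpectrum {Ω : Type*} [MeasurableSpace Ω] (μ : Measure Ω)
    (x : ℤ → Ω → ℂ) (P : ℕ) (k : ℤ) (f : ℝ) : ℂ :=
  (1 / (P : ℂ)) * ∑ n ∈ Finset.range P, ∑' m : ℤ,
    autocorr μ x n m *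
      Complex.exp (-(Complex.I * (2 * Real.pi * ((k : ℂ) * n / P + f * m))))

/-- Cyclic PSD matrix `[S_X(σ)]_{r,c} = S_X^{((r-c)/P)}(σ + r/P)`. -/
noncomputable def cyclicPSDMatrix {Ω : Type*} [MeasurableSpace Ω] (μ : Measure Ω)
    (x : ℤ → Ω → ℂ) (P : ℕ) (σ : ℝ) : Matrix (Fin P) (Fin P) ℂ :=
  Matrix.of fun r c => cyclicSpectrum μ x P ((r : ℤ) - (c : ℤ)) (σ + (r : ℝ) / P)

/-- `φ n t` (`t ∈ [0,1)`) is a Karhunen-Loève basis of the process, with KL spectrum `S`.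
The completeness relation `∑ₙ φ(n,t) φ*(n,t') = δ(t - t')` is an identity of distributions and
is written here integrated over `A × B`. -/
structure IsKLBasis {Ω : Type*} [MeasurableSpace Ω] (μ : Measure Ω)
    (x : ℤ → Ω → ℂ) (φ : ℤ → ℝ → ℂ) (S : ℝ → ℂ) : Prop where
  aestronglyMeasurable : ∀ n, AEStronglyMeasurable (φ n) (volume.restrict (Ico (0 : ℝ) 1))
  orthonormal : ∀ n n' : ℤ,
    ∫ t in Ico (0 : ℝ) 1, φ n t * conj (φ n' t) = if n = n' then 1 else 0
  complete : ∀ A B : Set ℝ, MeasurableSet A → MeasurableSet B →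
    A ⊆ Ico (0 : ℝ) 1 → B ⊆ Ico (0 : ℝ) 1 →
    HasSum (fun n : ℤ => (∫ t in A, φ n t) * ∫ t in B, conj (φ n t))
      ((volume.real (A ∩ B) : ℝ) : ℂ)
  eigenequation : ∀ t ∈ Ico (0 : ℝ) 1, ∀ k : ℤ,
    HasSum (fun l : ℤ => autocorr μ x l (k - l) * φ l t) (S t * φ k t)

/-- The cyclostationary form of the basis on the sub-bands `t = σ + p/P`, `σ ∈ [0,1/P)`:
`φ(n, σ + p/P) = ∑_q b^{(p)}(q,σ) e^{j2π(σ+q/P)n}`; here `b p q σ` is `b^{(p)}(q,σ)`. -/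
def HasCSForm (P : ℕ) (φ : ℤ → ℝ → ℂ) (b : Fin P → Fin P → ℝ → ℂ) : Prop :=
  ∀ p : Fin P, ∀ σ ∈ Ico (0 : ℝ) (1 / P), ∀ n : ℤ,
    φ n (σ + (p : ℝ) / P) =
      ∑ q : Fin P, b p q σ *
        Complex.exp (Complex.I * (2 * Real.pi * ((σ : ℂ) + (q : ℂ) / P) * n))

/-- The matrix `B_X(σ)`, whose columns are `b^{(0)}(σ), …, b^{(P-1)}(σ)`. -/
def basisMatrix (P : ℕ) (b : Fin P → Fin P → ℝ → ℂ) (σ : ℝ) : Matrix (Fin P) (Fin P) ℂ :=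
  Matrix.of fun q p => b p q σ

/-- The KL-PSD matrix: the diagonal matrix of the segmented KL spectrum
`S^{(p)}(σ) = S(σ + p/P)`. -/
noncomputable def klPSDMatrix (P : ℕ) (S : ℝ → ℂ) (σ : ℝ) : Matrix (Fin P) (Fin P) ℂ :=
  Matrix.diagonal fun p : Fin P => S (σ + (p : ℝ) / P)

/-- `ξ` is the KL transform of the process, as a random spectral set function:
`ξ(A) = ∫_A dξ` is the mean-square limit, as `M → ∞`, of
`∑_{n=-M}^{M-1} x(n) ∫_A φ*(n,t) dt`, for every measurable `A ⊆ [0,1)`. -/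
def IsKLTransform {Ω : Type*} [MeasurableSpace Ω] (μ : Measure Ω)
    (x : ℤ → Ω → ℂ) (φ : ℤ → ℝ → ℂ) (ξ : Set ℝ → Ω → ℂ) : Prop :=
  ∀ A : Set ℝ, MeasurableSet A → A ⊆ Ico (0 : ℝ) 1 →
    MemLp (ξ A) 2 μ ∧
    Tendsto (fun M : ℕ => eLpNorm (fun ω =>
        (∑ n ∈ Finset.Ico (-(M : ℤ)) (M : ℤ), x n ω * ∫ t in A, conj (φ n t)) - ξ A ω) 2 μ)
      atTop (𝓝 0)

/-- The vector of the increments of the `P` segmented KL spectral processes over a set `A` of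
values of `σ`: `p`-th entry `ξ^{(p)}(A) = ξ(A + p/P)`. -/
noncomputable def klVector {Ω : Type*} (P : ℕ) (ξ : Set ℝ → Ω → ℂ) (A : Set ℝ) (ω : Ω) :
    Fin P → ℂ :=
  fun p => ξ ((fun σ : ℝ => σ + (p : ℝ) / P) '' A) ω

/-- `p` is the average power `lim_N (1/N) ∑_{n=-N/2}^{N/2-1} E|x(n)|²`, with `N = 2M`. -/
def HasAveragePower {Ω : Type*} [MeasurableSpace Ω] (μ : Measure Ω)
    (x : ℤ → Ω → ℂ) (p : ℝ) : Prop :=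
  Tendsto (fun M : ℕ => (1 / (2 * (M : ℝ))) *
      ∑ n ∈ Finset.Ico (-(M : ℤ)) (M : ℤ), ∫ ω, ‖x n ω‖ ^ 2 ∂μ)
    atTop (𝓝 p)

/-! The argument is a Bloch decomposition. The cyclostationary form makes a shift of `n` by `w * P`
multiply every `φ n (σ + p/P)` by the same character `fourier w` of the circle of length `1/P`.
Orthonormality of the `φ n` therefore lists all the Fourier coefficients in `σ` of the Gram entries
of `segmentMatrix`, and these are the coefficients of the constant matrix `P • 1`. Since
`segmentMatrix = modeMatrix * basisMatrix` and `modeMatrix` is `√P` times a unitary, `basisMatrix`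
is unitary a.e. (`IsKLBasis.ae_basisMatrix_mem_unitaryGroup`). `cyclicPSDMatrix` is the
autocorrelation operator written in the modes, so the eigenequation becomes `S_X B = B D` with `D`
the KL-PSD matrix, for every `σ` (`IsKLBasis.cyclicPSDMatrix_mul_basisMatrix`).

For the covariance, the `x n` are vectors of `L²(μ)` whose Gram matrix has uniformly bounded
absolute row sums. By Schur's test, square-summable coefficients give convergent series, so `ξ(A)`
exists. The integrated eigenequation gives `⟪ξ(B), x k⟫ = ∫_B S φ k`, and Parseval for the indicator
of `A` then gives `∫_{A ∩ B} S` (`IsKLBasis.integral_klTransform_mul_conj`).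

The power is the mean of `r_x(n,0)` over a period. Integrating the spectrum at cycle frequency `0`
over `[0,1)` keeps only lag `0`, and the trace of `S_X` collects that integrand over the `P`
sub-bands. -/

/-! ### Uniqueness of Fourier coefficients -/

/-- An integrable function on `[0, T)` whose Fourier coefficients all vanish is zero a.e. -/
theorem ae_eq_zero_of_forall_integral_fourier_eq_zero {T : ℝ} (hT : 0 < T) {h : ℝ → ℂ}
    (hh : IntegrableOn h (Ico 0 T))
    (h0 : ∀ w : ℤ, ∫ t in Ico 0 T, h t * fourier w (t : AddCircle T) = 0) :
    ∀ᵐ t ∂volume.restrict (Ico 0 T), h t = 0 := by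
  have : Fact (0 < T) := ⟨hT⟩
  have hint : ∀ g : C(AddCircle T, ℂ),
      Integrable (fun t : ℝ => h t * g (t : AddCircle T)) (volume.restrict (Ico 0 T)) := by
    intro g
    refine hh.mul_bdd (c := ‖g‖) ?_ (Eventually.of_forall fun t => g.norm_coe_le_norm _)
    exact (g.continuous.comp (AddCircle.continuous_mk' T)).aestronglyMeasurable
  -- Pairing with `h` is continuous for the sup norm, so it vanishes on the closure of the
  -- trigonometric polynomials, which is all of `C(AddCircle T, ℂ)`.
  let L : C(AddCircle T, ℂ) →ₗ[ℂ] ℂ :=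
    { toFun := fun g => ∫ t in Ico 0 T, h t * g (t : AddCircle T)
      map_add' := fun g₁ g₂ => by
        rw [← integral_add (hint g₁) (hint g₂)]
        simp [mul_add]
      map_smul' := fun c g => by
        rw [RingHom.id_apply, smul_eq_mul, ← integral_const_mul]
        simp [mul_left_comm] }
  have hLb : ∀ g, ‖L g‖ ≤ (∫ t in Ico 0 T, ‖h t‖) * ‖g‖ := by
    intro g
    refine (norm_integral_le_integral_norm _).trans ?_
    rw [← integral_mul_const]
    refine integral_mono (hint g).norm (hh.norm.mul_const _) fun t => ?_
    simp only [norm_mul]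
    exact mul_le_mul_of_nonneg_left (g.norm_coe_le_norm _) (norm_nonneg _)
  have hzero : ∀ g : C(AddCircle T, ℂ), L.mkContinuous _ hLb g = 0 := by
    intro g
    have hle : (Submodule.span ℂ (range (fourier (T := T)))).topologicalClosure
        ≤ LinearMap.ker (L.mkContinuous _ hLb).toLinearMap := by
      refine Submodule.topologicalClosure_minimal _ ?_ (L.mkContinuous _ hLb).isClosed_ker
      rw [Submodule.span_le]
      rintro _ ⟨w, rfl⟩
      exact h0 w
    exact hle (by rw [span_fourier_closure_eq_top]; trivial)
  have hopen : ∀ᵐ t, t ∈ Ioo 0 T → h t = 0 := by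
    refine isOpen_Ioo.ae_eq_zero_of_integral_contDiff_smul_eq_zero
      (IntegrableOn.locallyIntegrableOn (hh.mono_set Ioo_subset_Ico_self)) ?_
    intro g hg _ hgs
    have hvan : ∀ t, t ∉ Ioo 0 T → g t = 0 := fun t ht =>
      image_eq_zero_of_notMem_tsupport fun h => ht (hgs h)
    -- A test function supported in the open interval vanishes at both ends, so it glues to a
    -- continuous function on the circle.
    let G : C(AddCircle T, ℂ) :=
      ⟨AddCircle.liftIco T 0 (fun t => (g t : ℂ)), AddCircle.liftIco_zero_continuous
        (by simp [hvan 0 (by simp), hvan T (by simp)])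
        (Complex.continuous_ofReal.comp hg.continuous).continuousOn⟩
    have hG := hzero G
    change ∫ t in Ico 0 T, h t * AddCircle.liftIco T 0 (fun t => (g t : ℂ)) t = 0 at hG
    rw [← hG, ← integral_indicator measurableSet_Ico]
    congr 1
    ext t
    by_cases ht : t ∈ Ico 0 T
    · rw [indicator_of_mem ht, AddCircle.liftIco_zero_coe_apply ht, Complex.real_smul, mul_comm]
    · rw [indicator_of_notMem ht, hvan t (fun h => ht (Ioo_subset_Ico_self h)), zero_smul]
  rw [← restrict_Ioo_eq_restrict_Ico, ae_restrict_iff' measurableSet_Ioo]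
  exact hopen

/-! ### Cutting `[0,1)` into `P` sub-bands -/

theorem add_div_mem_Ico_zero_one {P : ℕ} {σ : ℝ} (hσ : σ ∈ Ico (0 : ℝ) (1 / P)) (p : Fin P) :
    σ + (p : ℝ) / P ∈ Ico (0 : ℝ) 1 := by
  have hP' : (0 : ℝ) < P := by exact_mod_cast p.pos
  have h1 : ((p : ℕ) : ℝ) + 1 ≤ P := by exact_mod_cast p.2
  refine ⟨add_nonneg hσ.1 (by positivity), ?_⟩
  calc σ + (p : ℝ) / P < 1 / P + (p : ℝ) / P := by linarith [hσ.2]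
    _ = ((p : ℝ) + 1) / P := by ring
    _ ≤ 1 := (div_le_one hP').2 h1

/-- `[0, 1)` is the disjoint union of the translates of `[0, 1/P)` by `p/P`, `p < P`. -/
theorem restrict_Ico_zero_one_eq_sum {P : ℕ} (hP : 0 < P) :
    (volume.restrict (Ico (0 : ℝ) 1)) =
      ∑ p : Fin P, (volume.restrict (Ico (0 : ℝ) (1 / P))).map (fun σ => σ + (p : ℝ) / P) := by
  have hP' : (0 : ℝ) < P := by exact_mod_cast hP
  have hmap : ∀ p : Fin P,
      (volume.restrict (Ico (0 : ℝ) (1 / P))).map (fun σ => σ + (p : ℝ) / P) =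
        volume.restrict (Ico ((p : ℝ) / P) (((p : ℝ) + 1) / P)) := by
    intro p
    have := ((measurePreserving_add_right volume ((p : ℝ) / P)).restrict_image_emb
      (measurableEmbedding_addRight _) (Ico (0 : ℝ) (1 / P))).map_eq
    rw [this, image_add_const_Ico]
    congr 2 <;> ring
  have hU : Ico (0 : ℝ) 1 = ⋃ p : Fin P, Ico ((p : ℝ) / P) (((p : ℝ) + 1) / P) := by
    ext t
    simp only [mem_iUnion, mem_Ico]
    constructor
    · rintro ⟨h0, h1⟩
      have h2 : t * P < P := by nlinarith
      refine ⟨⟨⌊t * P⌋₊, (Nat.floor_lt (by positivity)).2 h2⟩, ?_, ?_⟩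
      · rw [div_le_iff₀ hP']; exact Nat.floor_le (by positivity)
      · rw [lt_div_iff₀ hP']; exact Nat.lt_floor_add_one _
    · rintro ⟨p, h0, h1⟩
      refine ⟨le_trans (by positivity) h0, h1.trans_le ?_⟩
      rw [div_le_one hP']
      exact_mod_cast p.2
  have hd : Pairwise (Function.onFun Disjoint
      fun p : Fin P => Ico ((p : ℝ) / P) (((p : ℝ) + 1) / P)) := by
    intro p q hpq
    rw [Function.onFun, Set.disjoint_left]
    rintro t ⟨h1, h2⟩ ⟨h3, h4⟩
    rw [div_le_iff₀ hP'] at h1 h3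
    rw [lt_div_iff₀ hP'] at h2 h4
    have h5 : ((p : ℕ) : ℝ) < (q : ℕ) + 1 := by linarith
    have h6 : ((q : ℕ) : ℝ) < (p : ℕ) + 1 := by linarith
    norm_cast at h5 h6
    exact hpq (Fin.ext (by omega))
  rw [hU, Measure.restrict_iUnion hd (fun _ => measurableSet_Ico), Measure.sum_fintype]
  exact Finset.sum_congr rfl fun p _ => (hmap p).symm

theorem ae_restrict_Ico_zero_one_iff {P : ℕ} (hP : 0 < P) {Q : ℝ → Prop} :
    (∀ᵐ t ∂volume.restrict (Ico (0 : ℝ) 1), Q t) ↔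
      ∀ p : Fin P, ∀ᵐ σ ∂volume.restrict (Ico (0 : ℝ) (1 / P)), Q (σ + (p : ℝ) / P) := by
  rw [restrict_Ico_zero_one_eq_sum hP, ae_finsetSum_measure_iff]
  simp only [Finset.mem_univ, true_imp_iff]
  refine forall_congr' fun p => ?_
  rw [(measurableEmbedding_addRight ((p : ℝ) / P)).ae_map_iff]

theorem integrableOn_Ico_zero_one_iff {P : ℕ} (hP : 0 < P) {g : ℝ → ℂ} :
    IntegrableOn g (Ico (0 : ℝ) 1) ↔
      ∀ p : Fin P, IntegrableOn (fun σ => g (σ + (p : ℝ) / P)) (Ico (0 : ℝ) (1 / P)) := by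
  rw [IntegrableOn, restrict_Ico_zero_one_eq_sum hP, integrable_finsetSum_measure]
  simp only [Finset.mem_univ, true_imp_iff]
  refine forall_congr' fun p => ?_
  rw [(measurableEmbedding_addRight ((p : ℝ) / P)).integrable_map_iff]
  rfl

theorem integral_Ico_zero_one_eq_sum {P : ℕ} (hP : 0 < P) {g : ℝ → ℂ}
    (hg : IntegrableOn g (Ico (0 : ℝ) 1)) :
    ∫ t in Ico (0 : ℝ) 1, g t =
      ∫ σ in Ico (0 : ℝ) (1 / P), ∑ p : Fin P, g (σ + (p : ℝ) / P) := by
  rw [integral_finsetSum _ fun p _ => (integrableOn_Ico_zero_one_iff hP).1 hg p]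
  rw [IntegrableOn, restrict_Ico_zero_one_eq_sum hP, integrable_finsetSum_measure] at hg
  rw [restrict_Ico_zero_one_eq_sum hP, integral_finsetSum_measure hg]
  exact Finset.sum_congr rfl fun p _ =>
    (measurableEmbedding_addRight ((p : ℝ) / P)).integral_map _

/-! ### Periodic sums and orthogonality of characters -/

/-- The sum of a `P`-periodic sequence over a period does not depend on the starting point. -/
theorem sum_range_add_of_periodic {M : Type*} [AddCommGroup M] {P : ℕ} {g : ℤ → M}
    (hg : Function.Periodic g P) (m : ℤ) :
    ∑ n ∈ Finset.range P, g (n + m) = ∑ n ∈ Finset.range P, g n := by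
  have step : ∀ m : ℤ, ∑ n ∈ Finset.range P, g (n + (m + 1)) = ∑ n ∈ Finset.range P, g (n + m) := by
    intro m
    have h1 := Finset.sum_range_succ (fun n : ℕ => g (n + m)) P
    have h2 := Finset.sum_range_succ' (fun n : ℕ => g (n + m)) P
    have h3 : g (P + m) = g m := by rw [add_comm]; exact hg m
    rw [h1] at h2
    simp only [h3, Nat.cast_add, Nat.cast_one, Nat.cast_zero, zero_add, add_left_inj] at h2
    rw [h2]
    exact Finset.sum_congr rfl fun n _ => by congr 1; ring
  induction m using Int.induction_on with
  | zero => simp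
  | succ i ih => rw [step, ih]
  | pred i ih => rw [← ih, ← step, sub_add_cancel]

/-- The integral over `[0, T)` of a nontrivial character of period `T` vanishes. -/
theorem integral_Ico_exp_int {T : ℝ} (hT : 0 < T) (w : ℤ) :
    ∫ t in Ico 0 T, Complex.exp (2 * Real.pi * Complex.I * w * t / T) =
      if w = 0 then (T : ℂ) else 0 := by
  have hTC : (T : ℂ) ≠ 0 := by exact_mod_cast hT.ne'
  split_ifs with hw
  · simp [hw, hT.le]
  · rw [integral_Ico_eq_integral_Ioc, ← intervalIntegral.integral_of_le hT.le]
    have hc : 2 * Real.pi * Complex.I * w / T ≠ 0 := by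
      have : (w : ℂ) ≠ 0 := by exact_mod_cast hw
      have := Real.pi_ne_zero
      simp_all
    have h := integral_exp_mul_complex (a := 0) (b := T) hc
    have h1 : Complex.exp (2 * Real.pi * Complex.I * w / T * T) = 1 := by
      rw [div_mul_cancel₀ _ hTC, Complex.exp_eq_one_iff]
      exact ⟨w, by ring⟩
    rw [h1] at h
    simp only [Complex.ofReal_zero, mul_zero, Complex.exp_zero, sub_self, zero_div] at h
    rw [← h]
    refine intervalIntegral.integral_congr fun t _ => ?_
    congr 1; ring

/-- Orthogonality of the characters of `ℤ / P`. -/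
theorem sum_range_exp_div {P : ℕ} (hP : 0 < P) (q r : Fin P) :
    ∑ n ∈ Finset.range P,
        Complex.exp (2 * Real.pi * Complex.I * ((q : ℂ) - (r : ℂ)) * n / P) =
      if q = r then (P : ℂ) else 0 := by
  have hPC : (P : ℂ) ≠ 0 := by exact_mod_cast hP.ne'
  have hpow : ∀ n : ℕ, Complex.exp (2 * Real.pi * Complex.I * ((q : ℂ) - (r : ℂ)) * n / P) =
      Complex.exp (2 * Real.pi * Complex.I * ((q : ℂ) - (r : ℂ)) / P) ^ n := by
    intro n
    rw [← Complex.exp_nat_mul]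
    congr 1; ring
  split_ifs with h
  · simp [h]
  · simp only [hpow]
    have h1 : Complex.exp (2 * Real.pi * Complex.I * ((q : ℂ) - (r : ℂ)) / P) ≠ 1 := by
      rw [Ne, Complex.exp_eq_one_iff]
      rintro ⟨n, hn⟩
      have h2pi := Complex.two_pi_I_ne_zero
      rw [div_eq_iff hPC, mul_comm (n : ℂ), mul_assoc (2 * (Real.pi : ℂ) * Complex.I)] at hn
      have hn := mul_left_cancel₀ h2pi hn
      have hz : ((q : ℕ) : ℤ) - ((r : ℕ) : ℤ) = n * P := by exact_mod_cast hn
      have hq := q.2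
      have hr := r.2
      have hne : (q : ℕ) ≠ r := fun h' => h (Fin.ext h')
      have hdvd : (P : ℤ) ∣ ((q : ℕ) : ℤ) - ((r : ℕ) : ℤ) := ⟨n, by rw [hz, mul_comm]⟩
      have := Int.eq_zero_of_abs_lt_dvd hdvd (by rw [abs_lt]; constructor <;> omega)
      omega
    rw [geom_sum_eq h1, ← Complex.exp_nat_mul]
    have h2 : Complex.exp (P * (2 * Real.pi * Complex.I * ((q : ℂ) - (r : ℂ)) / P)) = 1 := by
      rw [mul_div_cancel₀ _ hPC, Complex.exp_eq_one_iff]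
      exact ⟨(q : ℤ) - (r : ℤ), by push_cast; ring⟩
    rw [h2, sub_self, zero_div]

/-! ### Diagonalization by a unitary matrix -/

/-- If the columns of a unitary matrix are eigenvectors, the eigenvalues are the roots of the
characteristic polynomial. -/
theorem charpoly_roots_of_mul_eq_mul_diagonal {n : Type*} [Fintype n] [DecidableEq n]
    {A U : Matrix n n ℂ} {d : n → ℂ} (hU : U ∈ Matrix.unitaryGroup n ℂ)
    (h : A * U = U * Matrix.diagonal d) : A.charpoly.roots = Finset.univ.val.map d := by
  have h1 : U * star U = 1 := (Matrix.mem_unitaryGroup_iff).1 hU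
  have h2 : star U * U = 1 := (Matrix.mem_unitaryGroup_iff').1 hU
  have hA : A = U * Matrix.diagonal d * star U := by rw [← h, mul_assoc, h1, mul_one]
  rw [hA, Matrix.charpoly_mul_comm, ← mul_assoc, h2, one_mul, Matrix.charpoly_diagonal]
  have := Polynomial.roots_multiset_prod_X_sub_C (Finset.univ.val.map d)
  rwa [Multiset.map_map] at this

theorem trace_of_mul_eq_mul_diagonal {n : Type*} [Fintype n] [DecidableEq n]
    {A U : Matrix n n ℂ} {d : n → ℂ} (hU : U ∈ Matrix.unitaryGroup n ℂ)
    (h : A * U = U * Matrix.diagonal d) : A.trace = (Matrix.diagonal d).trace := by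
  have h1 : U * star U = 1 := (Matrix.mem_unitaryGroup_iff).1 hU
  have h2 : star U * U = 1 := (Matrix.mem_unitaryGroup_iff').1 hU
  have hA : A = U * Matrix.diagonal d * star U := by rw [← h, mul_assoc, h1, mul_one]
  rw [hA, Matrix.trace_mul_comm, ← mul_assoc, h2, one_mul]

/-! ### Schur's test and orthonormal expansions -/

section Hilbert

open scoped InnerProductSpace

variable {H ι : Type*} [NormedAddCommGroup H] [InnerProductSpace ℂ H]

/-- Schur's test for the Gram matrix of a family of vectors. -/
theorem norm_sq_sum_smul_le {X : ι → H} {C : ℝ}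
    (hC : ∀ k (F : Finset ι), ∑ l ∈ F, ‖⟪X k, X l⟫_ℂ‖ ≤ C) (c : ι → ℂ) (F : Finset ι) :
    ‖∑ n ∈ F, c n • X n‖ ^ 2 ≤ C * ∑ n ∈ F, ‖c n‖ ^ 2 := by
  -- Each `‖c k‖ * ‖c l‖` is split by the AM-GM inequality; by symmetry of the Gram moduli both
  -- halves obey the same row-sum bound.
  have h1 : ‖∑ n ∈ F, c n • X n‖ ^ 2 ≤
      ∑ k ∈ F, ∑ l ∈ F, (‖c k‖ ^ 2 * ‖⟪X k, X l⟫_ℂ‖ + ‖c l‖ ^ 2 * ‖⟪X l, X k⟫_ℂ‖) / 2 := by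
    rw [← inner_self_eq_norm_sq (𝕜 := ℂ), inner_self_re_eq_norm, sum_inner]
    refine (norm_sum_le _ _).trans (Finset.sum_le_sum fun k _ => ?_)
    rw [inner_sum]
    refine (norm_sum_le _ _).trans (Finset.sum_le_sum fun l _ => ?_)
    rw [inner_smul_left, inner_smul_right, norm_mul, norm_mul, RCLike.norm_conj,
      norm_inner_symm (X l) (X k)]
    nlinarith [mul_nonneg (sq_nonneg (‖c k‖ - ‖c l‖)) (norm_nonneg ⟪X k, X l⟫_ℂ)]
  refine h1.trans ?_
  have h2 : ∑ k ∈ F, ∑ l ∈ F, ‖c k‖ ^ 2 * ‖⟪X k, X l⟫_ℂ‖ ≤ C * ∑ n ∈ F, ‖c n‖ ^ 2 := by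
    rw [Finset.mul_sum]
    refine Finset.sum_le_sum fun k _ => ?_
    rw [← Finset.mul_sum, mul_comm]
    exact mul_le_mul_of_nonneg_right (hC k F) (sq_nonneg _)
  have h3 : ∑ k ∈ F, ∑ l ∈ F, ‖c l‖ ^ 2 * ‖⟪X l, X k⟫_ℂ‖ ≤ C * ∑ n ∈ F, ‖c n‖ ^ 2 := by
    rw [Finset.sum_comm]; exact h2
  simp only [← Finset.sum_div, Finset.sum_add_distrib]
  linarith

/-- Cauchy's criterion: Schur's test controls finite blocks of the vector series by blocks of `∑ ‖c
n‖ ^ 2`. -/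
theorem summable_smul_of_gram_bound [CompleteSpace H] {X : ι → H} {C : ℝ}
    (hC : ∀ k (F : Finset ι), ∑ l ∈ F, ‖⟪X k, X l⟫_ℂ‖ ≤ C) {c : ι → ℂ}
    (hc : Summable fun n => ‖c n‖ ^ 2) : Summable fun n => c n • X n := by
  rw [summable_iff_vanishing_norm]
  intro ε hε
  -- `|C| + 1` is a positive denominator dominating `C`, whose sign is not given.
  obtain ⟨s, hs⟩ := summable_iff_vanishing_norm.1 hc (ε ^ 2 / (|C| + 1)) (by positivity)
  refine ⟨s, fun t ht => ?_⟩
  have h1 := hs t ht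
  rw [Real.norm_of_nonneg (by positivity), lt_div_iff₀ (by positivity)] at h1
  have h2 := norm_sq_sum_smul_le hC c t
  have h3 : 0 ≤ ∑ n ∈ t, ‖c n‖ ^ 2 := by positivity
  refine lt_of_pow_lt_pow_left₀ 2 hε.le (h2.trans_lt ?_)
  nlinarith [le_abs_self C]

/-- If Bessel's inequality for `x` is an equality, `x` is the sum of its orthonormal expansion. -/
theorem Orthonormal.hasSum_inner_smul {v : ι → H} (hv : Orthonormal ℂ v) {x : H}
    (h : HasSum (fun i => ‖⟪v i, x⟫_ℂ‖ ^ 2) (‖x‖ ^ 2)) :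
    HasSum (fun i => ⟪v i, x⟫_ℂ • v i) x := by
  -- The squared error of a partial expansion is exactly the deficit in Bessel's inequality.
  have key : ∀ F : Finset ι, ‖∑ i ∈ F, ⟪v i, x⟫_ℂ • v i - x‖ ^ 2 =
      ‖x‖ ^ 2 - ∑ i ∈ F, ‖⟪v i, x⟫_ℂ‖ ^ 2 := by
    intro F
    have h1 : ⟪∑ i ∈ F, ⟪v i, x⟫_ℂ • v i, x⟫_ℂ = ((∑ i ∈ F, ‖⟪v i, x⟫_ℂ‖ ^ 2 : ℝ) : ℂ) := by
      rw [sum_inner]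
      push_cast
      refine Finset.sum_congr rfl fun i _ => ?_
      rw [inner_smul_left, ← Complex.normSq_eq_conj_mul_self, Complex.normSq_eq_norm_sq]
      push_cast; rfl
    have h2 : ⟪∑ i ∈ F, ⟪v i, x⟫_ℂ • v i, ∑ i ∈ F, ⟪v i, x⟫_ℂ • v i⟫_ℂ =
        ((∑ i ∈ F, ‖⟪v i, x⟫_ℂ‖ ^ 2 : ℝ) : ℂ) := by
      rw [hv.inner_sum]
      push_cast
      refine Finset.sum_congr rfl fun i _ => ?_
      rw [← Complex.normSq_eq_conj_mul_self, Complex.normSq_eq_norm_sq]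
      push_cast; rfl
    have h3 : ‖∑ i ∈ F, ⟪v i, x⟫_ℂ • v i‖ ^ 2 = ∑ i ∈ F, ‖⟪v i, x⟫_ℂ‖ ^ 2 := by
      rw [← inner_self_eq_norm_sq (𝕜 := ℂ), h2]
      exact Complex.ofReal_re _
    rw [norm_sub_sq (𝕜 := ℂ), h1, h3]
    simp only [RCLike.re_to_complex, Complex.ofReal_re]
    ring
  rw [HasSum, tendsto_iff_norm_sub_tendsto_zero]
  have h4 : Tendsto (fun F : Finset ι => ‖x‖ ^ 2 - ∑ i ∈ F, ‖⟪v i, x⟫_ℂ‖ ^ 2)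
      (SummationFilter.unconditional ι).filter (𝓝 0) := by
    have := (tendsto_const_nhds (x := ‖x‖ ^ 2)).sub h
    rwa [sub_self] at this
  have h5 := (Real.continuous_sqrt.tendsto 0).comp h4
  rw [Real.sqrt_zero] at h5
  refine h5.congr fun F => ?_
  rw [Function.comp, ← key, Real.sqrt_sq (norm_nonneg _)]

end Hilbert

/-! ### The autocorrelation as a Gram matrix -/

section Autocorrelation

variable {Ω : Type*} [MeasurableSpace Ω] {μ : Measure Ω} {x : ℤ → Ω → ℂ} {P : ℕ}

theorem inner_toLp_eq_autocorr (hx : ∀ n, MemLp (x n) 2 μ) (k l : ℤ) :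
    inner ℂ ((hx l).toLp (x l)) ((hx k).toLp (x k)) = autocorr μ x l (k - l) := by
  rw [L2.inner_def, autocorr]
  refine integral_congr_ae ?_
  filter_upwards [(hx l).coeFn_toLp, (hx k).coeFn_toLp] with ω h1 h2
  rw [h1, h2, RCLike.inner_apply, add_sub_cancel]

/-- Hermitian symmetry of the Gram matrix. It trades a sum over base times for a sum over lags at
the fixed time `k`, where summability is assumed. -/
theorem norm_autocorr_swap (k l : ℤ) :
    ‖autocorr μ x l (k - l)‖ = ‖autocorr μ x k (l - k)‖ := by
  rw [autocorr, autocorr, ← RCLike.norm_conj, ← integral_conj]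
  simp [mul_comm]

theorem summable_norm_autocorr_column (hsum : ∀ n : ℤ, Summable fun m : ℤ => autocorr μ x n m)
    (k : ℤ) : Summable fun l : ℤ => ‖autocorr μ x l (k - l)‖ := by
  simp only [norm_autocorr_swap k]
  exact (Equiv.subRight k).summable_iff.2 (hsum k).norm

theorem exists_bound_tsum_norm_autocorr (hP : 0 < P) (hcs : IsCyclostationary μ x P) :
    ∃ C : ℝ, 0 ≤ C ∧ ∀ k : ℤ, ∑' l : ℤ, ‖autocorr μ x l (k - l)‖ ≤ C := by
  -- Periodicity leaves only `P` distinct row sums; their total bounds each of them.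
  refine ⟨∑ n ∈ Finset.range P, ∑' m : ℤ, ‖autocorr μ x n m‖,
    Finset.sum_nonneg fun _ _ => tsum_nonneg fun _ => norm_nonneg _, fun k => ?_⟩
  simp only [norm_autocorr_swap k]
  have hshift : ∑' l : ℤ, ‖autocorr μ x k (l - k)‖ = ∑' m : ℤ, ‖autocorr μ x k m‖ :=
    (Equiv.subRight k).tsum_eq fun m => ‖autocorr μ x k m‖
  rw [hshift]
  have hP' : (0 : ℤ) < P := by exact_mod_cast hP
  have hmod : ∀ m, autocorr μ x k m = autocorr μ x ((k % P).toNat : ℤ) m := by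
    intro m
    rw [hcs k m (-(k / P)), Int.toNat_of_nonneg (Int.emod_nonneg _ hP'.ne')]
    congr 1
    have := Int.emod_add_mul_ediv k P
    linarith
  simp only [hmod]
  refine Finset.single_le_sum (f := fun n : ℕ => ∑' m : ℤ, ‖autocorr μ x n m‖)
    (fun _ _ => tsum_nonneg fun _ => norm_nonneg _) (Finset.mem_range.2 ?_)
  have := Int.emod_lt_of_pos k hP'
  have := Int.emod_nonneg k hP'.ne'
  omega

theorem sum_norm_inner_toLp_le (hx : ∀ n, MemLp (x n) 2 μ)
    (hsum : ∀ n : ℤ, Summable fun m : ℤ => autocorr μ x n m) {C : ℝ}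
    (hC : ∀ k : ℤ, ∑' l : ℤ, ‖autocorr μ x l (k - l)‖ ≤ C) (k : ℤ) (F : Finset ℤ) :
    ∑ l ∈ F, ‖inner ℂ ((hx k).toLp (x k)) ((hx l).toLp (x l))‖ ≤ C := by
  refine le_trans ?_ (hC k)
  simp only [inner_toLp_eq_autocorr, ← norm_autocorr_swap k]
  exact (summable_norm_autocorr_column hsum k).sum_le_tsum F fun _ _ => norm_nonneg _

end Autocorrelation

/-! ### Modes, and the basis over one period -/

section Modes

variable {P : ℕ}

/-- The complex exponential of frequency `σ + q / P`. -/
noncomputable def fourierMode (P : ℕ) (q : Fin P) (σ : ℝ) (n : ℤ) : ℂ :=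
  Complex.exp (Complex.I * (2 * Real.pi * ((σ : ℂ) + (q : ℂ) / P) * n))

theorem conj_fourierMode (q : Fin P) (σ : ℝ) (n : ℤ) :
    conj (fourierMode P q σ n) =
      Complex.exp (-(Complex.I * (2 * Real.pi * ((σ : ℂ) + (q : ℂ) / P) * n))) := by
  rw [fourierMode, ← Complex.exp_conj]
  simp [map_ofNat]

theorem norm_fourierMode (q : Fin P) (σ : ℝ) (n : ℤ) : ‖fourierMode P q σ n‖ = 1 := by
  rw [fourierMode, Complex.norm_exp]
  simp

/-- The part `q/P` of the frequency contributes `exp (2πi q w) = 1`, so the shift factor does not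
depend on `q`. -/
theorem fourierMode_add_mul (hP : 0 < P) (q : Fin P) (σ : ℝ) (n w : ℤ) :
    fourierMode P q σ (n + w * P) =
      fourier w (σ : AddCircle (1 / (P : ℝ))) * fourierMode P q σ n := by
  have hPC : (P : ℂ) ≠ 0 := by exact_mod_cast hP.ne'
  rw [fourier_coe_apply, fourierMode, fourierMode, ← Complex.exp_add, Complex.exp_eq_exp_iff_exists_int]
  refine ⟨q * w, ?_⟩
  push_cast
  field_simp
  ring

theorem sum_conj_fourierMode_mul (hP : 0 < P) (q r : Fin P) (σ : ℝ) :
    ∑ n ∈ Finset.range P, conj (fourierMode P r σ n) * fourierMode P q σ n =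
      if q = r then (P : ℂ) else 0 := by
  rw [← sum_range_exp_div hP q r]
  refine Finset.sum_congr rfl fun n _ => ?_
  rw [conj_fourierMode, fourierMode, ← Complex.exp_add]
  congr 1
  push_cast
  ring

/-- The matrix whose columns are one period of the modes. -/
noncomputable def modeMatrix (P : ℕ) (σ : ℝ) : Matrix (Fin P) (Fin P) ℂ :=
  Matrix.of fun a q => fourierMode P q σ (a : ℕ)

/-- One period of the segmented basis functions `φ(·, σ + p/P)`, as columns. -/
noncomputable def segmentMatrix (P : ℕ) (φ : ℤ → ℝ → ℂ) (σ : ℝ) : Matrix (Fin P) (Fin P) ℂ :=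
  Matrix.of fun a p => φ (a : ℕ) (σ + (p : ℝ) / P)

theorem conjTranspose_modeMatrix_mul_self (hP : 0 < P) (σ : ℝ) :
    (modeMatrix P σ).conjTranspose * modeMatrix P σ = (P : ℂ) • 1 := by
  ext r q
  rw [Matrix.mul_apply, Matrix.smul_apply, Matrix.one_apply]
  simp only [Matrix.conjTranspose_apply, modeMatrix, Matrix.of_apply]
  have h := sum_conj_fourierMode_mul hP q r σ
  rw [← Fin.sum_univ_eq_sum_range
    (fun n : ℕ => conj (fourierMode P r σ n) * fourierMode P q σ n)] at h
  simp only [starRingEnd_apply] at h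
  rw [h]
  by_cases hqr : q = r
  · simp [hqr]
  · simp [hqr, Ne.symm hqr]

variable {φ : ℤ → ℝ → ℂ} {b : Fin P → Fin P → ℝ → ℂ}

theorem HasCSForm.eq_sum (hb : HasCSForm P φ b) {σ : ℝ} (hσ : σ ∈ Ico (0 : ℝ) (1 / P)) (p : Fin P)
    (n : ℤ) : φ n (σ + (p : ℝ) / P) = ∑ q, b p q σ * fourierMode P q σ n :=
  hb p σ hσ n

/-- Bloch quasi-periodicity: the common factor leaves the sum over modes. It also shows that `‖φ n
(σ + p/P)‖` is `P`-periodic in `n`. -/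
theorem HasCSForm.apply_add_mul (hb : HasCSForm P φ b) (hP : 0 < P) {σ : ℝ}
    (hσ : σ ∈ Ico (0 : ℝ) (1 / P)) (p : Fin P) (n w : ℤ) :
    φ (n + w * P) (σ + (p : ℝ) / P) =
      fourier w (σ : AddCircle (1 / (P : ℝ))) * φ n (σ + (p : ℝ) / P) := by
  rw [hb.eq_sum hσ, hb.eq_sum hσ, Finset.mul_sum]
  refine Finset.sum_congr rfl fun q _ => ?_
  rw [fourierMode_add_mul hP]
  ring

theorem HasCSForm.segmentMatrix_eq (hb : HasCSForm P φ b) {σ : ℝ}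
    (hσ : σ ∈ Ico (0 : ℝ) (1 / P)) :
    segmentMatrix P φ σ = modeMatrix P σ * basisMatrix P b σ := by
  ext a p
  rw [Matrix.mul_apply]
  simp only [segmentMatrix, modeMatrix, basisMatrix, Matrix.of_apply]
  rw [hb.eq_sum hσ]
  exact Finset.sum_congr rfl fun q _ => mul_comm _ _

theorem HasCSForm.basisMatrix_eq (hb : HasCSForm P φ b) (hP : 0 < P) {σ : ℝ}
    (hσ : σ ∈ Ico (0 : ℝ) (1 / P)) :
    basisMatrix P b σ =
      (P : ℂ)⁻¹ • ((modeMatrix P σ).conjTranspose * segmentMatrix P φ σ) := by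
  have hPC : (P : ℂ) ≠ 0 := by exact_mod_cast hP.ne'
  rw [hb.segmentMatrix_eq hσ, ← mul_assoc, conjTranspose_modeMatrix_mul_self hP, smul_mul_assoc,
    one_mul, smul_smul, inv_mul_cancel₀ hPC, one_smul]

/-- With `M` the mode matrix and `G` the segment matrix, `B = P⁻¹ Mᴴ G`, hence `B Bᴴ = P⁻² Mᴴ (G Gᴴ)
M = P⁻¹ Mᴴ M = 1`. -/
theorem HasCSForm.basisMatrix_mem_unitaryGroup (hb : HasCSForm P φ b) (hP : 0 < P) {σ : ℝ}
    (hσ : σ ∈ Ico (0 : ℝ) (1 / P))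
    (h : segmentMatrix P φ σ * (segmentMatrix P φ σ).conjTranspose = (P : ℂ) • 1) :
    basisMatrix P b σ ∈ Matrix.unitaryGroup (Fin P) ℂ := by
  have hPC : (P : ℂ) ≠ 0 := by exact_mod_cast hP.ne'
  rw [Matrix.mem_unitaryGroup_iff, Matrix.star_eq_conjTranspose, hb.basisMatrix_eq hP hσ,
    Matrix.conjTranspose_smul, Matrix.conjTranspose_mul, Matrix.conjTranspose_conjTranspose,
    smul_mul_smul_comm, mul_assoc, ← mul_assoc (segmentMatrix P φ σ), h, smul_mul_assoc, one_mul,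
    mul_smul_comm, conjTranspose_modeMatrix_mul_self hP, smul_smul, smul_smul]
  simp [hPC]

theorem HasCSForm.sum_norm_sq_eq (hb : HasCSForm P φ b) (hP : 0 < P) {σ : ℝ}
    (hσ : σ ∈ Ico (0 : ℝ) (1 / P)) (h : basisMatrix P b σ ∈ Matrix.unitaryGroup (Fin P) ℂ)
    (p : Fin P) :
    ∑ k ∈ Finset.range P, conj (φ k (σ + (p : ℝ) / P)) * φ k (σ + (p : ℝ) / P) = P := by
  have h1 : (segmentMatrix P φ σ).conjTranspose * segmentMatrix P φ σ = (P : ℂ) • 1 := by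
    rw [hb.segmentMatrix_eq hσ, Matrix.conjTranspose_mul, mul_assoc,
      ← mul_assoc (modeMatrix P σ).conjTranspose, conjTranspose_modeMatrix_mul_self hP,
      smul_mul_assoc, one_mul, mul_smul_comm, ← Matrix.star_eq_conjTranspose,
      Matrix.mem_unitaryGroup_iff'.1 h]
  have h2 := congrFun (congrFun h1 p) p
  rw [Matrix.mul_apply, Matrix.smul_apply, Matrix.one_apply_eq, smul_eq_mul, mul_one] at h2
  rw [← h2, ← Fin.sum_univ_eq_sum_range
    (fun k : ℕ => conj (φ k (σ + (p : ℝ) / P)) * φ k (σ + (p : ℝ) / P))]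
  rfl

end Modes

/-! ### Unitarity of the basis matrix and the matrix eigenequation -/

section KLBasis

variable {Ω : Type*} [MeasurableSpace Ω] {μ : Measure Ω} {x : ℤ → Ω → ℂ} {P : ℕ}
  {φ : ℤ → ℝ → ℂ} {S : ℝ → ℂ} {b : Fin P → Fin P → ℝ → ℂ}

theorem IsKLBasis.memLp (hφ : IsKLBasis μ x φ S) (n : ℤ) :
    MemLp (φ n) 2 (volume.restrict (Ico (0 : ℝ) 1)) := by
  rw [memLp_two_iff_integrable_sq_norm (hφ.aestronglyMeasurable n)]
  have h1 : Integrable (fun t => φ n t * conj (φ n t)) (volume.restrict (Ico (0 : ℝ) 1)) := by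
    -- A nonintegrable function has Bochner integral `0`, whereas orthonormality gives `1`.
    by_contra h
    have := hφ.orthonormal n n
    rw [integral_undef h] at this
    simp at this
  refine h1.norm.congr (Eventually.of_forall fun t => ?_)
  simp [sq]

theorem IsKLBasis.integrable_mul_conj (hφ : IsKLBasis μ x φ S) (n n' : ℤ) :
    IntegrableOn (fun t => φ n t * conj (φ n' t)) (Ico (0 : ℝ) 1) :=
  (hφ.memLp n).integrable_mul (hφ.memLp n').star

/-- By quasi-periodicity, the inner product of `φ (a + w P)` and `φ c` over `[0,1)` is the integral
over `[0,1/P)` of the `(a,c)` entry of `G Gᴴ` against `fourier w`. Orthonormality thus fixes every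
Fourier coefficient of that entry. -/
theorem IsKLBasis.ae_segmentMatrix_mul (hφ : IsKLBasis μ x φ S) (hb : HasCSForm P φ b)
    (hP : 0 < P) : ∀ᵐ σ ∂volume.restrict (Ico (0 : ℝ) (1 / P)),
      segmentMatrix P φ σ * (segmentMatrix P φ σ).conjTranspose = (P : ℂ) • 1 := by
  have hP' : (0 : ℝ) < 1 / P := by positivity
  have hPC : (P : ℂ) ≠ 0 := by exact_mod_cast hP.ne'
  have key : ∀ a c : Fin P, ∀ᵐ σ ∂volume.restrict (Ico (0 : ℝ) (1 / P)),
      (∑ p : Fin P, φ (a : ℕ) (σ + (p : ℝ) / P) * conj (φ (c : ℕ) (σ + (p : ℝ) / P))) -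
        (if a = c then (P : ℂ) else 0) = 0 := by
    intro a c
    have hint : ∀ n : ℤ, IntegrableOn (fun σ => ∑ p : Fin P,
        φ n (σ + (p : ℝ) / P) * conj (φ (c : ℕ) (σ + (p : ℝ) / P))) (Ico (0 : ℝ) (1 / P)) :=
      fun n => integrable_finsetSum _ fun p _ =>
        (integrableOn_Ico_zero_one_iff hP).1 (hφ.integrable_mul_conj n (c : ℕ)) p
    have hconst : ∀ z : ℂ, IntegrableOn (fun _ : ℝ => z) (Ico (0 : ℝ) (1 / P)) := fun z =>
      integrableOn_const (by simp)
    refine ae_eq_zero_of_forall_integral_fourier_eq_zero hP' ((hint _).sub (hconst _)) fun w => ?_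
    have hsplit : ∀ σ ∈ Ico (0 : ℝ) (1 / P),
        ((∑ p : Fin P, φ (a : ℕ) (σ + (p : ℝ) / P) * conj (φ (c : ℕ) (σ + (p : ℝ) / P))) -
          (if a = c then (P : ℂ) else 0)) * fourier w (σ : AddCircle (1 / (P : ℝ))) =
        (∑ p : Fin P, φ ((a : ℕ) + w * P) (σ + (p : ℝ) / P) *
          conj (φ (c : ℕ) (σ + (p : ℝ) / P))) -
        (if a = c then (P : ℂ) else 0) *
          Complex.exp (2 * Real.pi * Complex.I * w * σ / (1 / (P : ℝ) : ℝ)) := by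
      intro σ hσ
      rw [sub_mul, fourier_coe_apply, Finset.sum_mul]
      congr 1
      refine Finset.sum_congr rfl fun p _ => ?_
      rw [hb.apply_add_mul hP hσ, fourier_coe_apply]
      ring
    rw [setIntegral_congr_fun measurableSet_Ico hsplit, integral_sub (hint _), integral_const_mul,
      integral_Ico_exp_int hP', ← integral_Ico_zero_one_eq_sum hP (hφ.integrable_mul_conj _ _),
      hφ.orthonormal]
    -- Both `a` and `c` lie in `[0,P)`, so a difference divisible by `P` must be `0`.
    · have hiff : (((a : ℕ) : ℤ) + w * P = (c : ℕ)) ↔ (a = c ∧ w = 0) := by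
        constructor
        · intro h
          have ha := a.2
          have hc := c.2
          have hdvd : (P : ℤ) ∣ ((c : ℕ) : ℤ) - ((a : ℕ) : ℤ) := ⟨w, by rw [← h]; ring⟩
          have h0 := Int.eq_zero_of_abs_lt_dvd hdvd (by rw [abs_lt]; constructor <;> omega)
          have hac : a = c := Fin.ext (by omega)
          refine ⟨hac, ?_⟩
          subst hac
          have : w * (P : ℤ) = 0 := by linarith
          rcases mul_eq_zero.1 this with h | h
          · exact h
          · omega
        · rintro ⟨rfl, rfl⟩
          simp
      rw [if_congr hiff rfl rfl]
      by_cases h1 : a = c <;> by_cases h2 : w = 0 <;> simp [h1, h2, hPC]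
    · refine Integrable.const_mul ?_ _
      refine (Continuous.integrableOn_Icc (a := 0) (b := 1 / (P : ℝ)) ?_).mono_set Ico_subset_Icc_self
      fun_prop
  have key' := ae_all_iff.2 fun a => ae_all_iff.2 (key a)
  filter_upwards [key'] with σ h
  ext a c
  rw [Matrix.mul_apply, Matrix.smul_apply, Matrix.one_apply]
  simp only [Matrix.conjTranspose_apply, segmentMatrix, Matrix.of_apply]
  have := sub_eq_zero.1 (h a c)
  simp only [starRingEnd_apply] at this
  rw [this]
  simp

theorem IsKLBasis.ae_basisMatrix_mem_unitaryGroup (hφ : IsKLBasis μ x φ S)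
    (hb : HasCSForm P φ b) (hP : 0 < P) : ∀ᵐ σ ∂volume.restrict (Ico (0 : ℝ) (1 / P)),
      basisMatrix P b σ ∈ Matrix.unitaryGroup (Fin P) ℂ := by
  filter_upwards [hφ.ae_segmentMatrix_mul hb hP, ae_restrict_mem measurableSet_Ico] with σ h hσ
  exact hb.basisMatrix_mem_unitaryGroup hP hσ h

/-- The cyclic PSD matrix is the matrix of the autocorrelation operator in the basis of modes. -/
theorem cyclicPSDMatrix_apply_eq (hP : 0 < P) (hcs : IsCyclostationary μ x P)
    (hsum : ∀ n : ℤ, Summable fun m : ℤ => autocorr μ x n m) (σ : ℝ) (r c : Fin P) :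
    cyclicPSDMatrix μ x P σ r c = (P : ℂ)⁻¹ * ∑ k ∈ Finset.range P, conj (fourierMode P r σ k) *
      ∑' l : ℤ, autocorr μ x l (k - l) * fourierMode P c σ l := by
  have hPC : (P : ℂ) ≠ 0 := by exact_mod_cast hP.ne'
  -- Lag `m` and time `n`, with the phases regrouped as modes at `n + m` and `n`. Under `n ↦ n + P`
  -- their shift factors are conjugate and cancel, so `g m` is periodic.
  let g : ℤ → ℤ → ℂ := fun m n =>
    autocorr μ x n m * (conj (fourierMode P r σ (n + m)) * fourierMode P c σ n)
  have hnorm : ∀ m n, ‖g m n‖ = ‖autocorr μ x n m‖ := by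
    intro m n
    simp [g, norm_fourierMode]
  have hper : ∀ m, Function.Periodic (g m) P := by
    intro m n
    have h1 := fourierMode_add_mul hP r σ (n + m) 1
    have h2 := fourierMode_add_mul hP c σ n 1
    have h3 := hcs n m 1
    have h4 : (conj (fourier 1 (σ : AddCircle (1 / (P : ℝ))))) *
        fourier 1 (σ : AddCircle (1 / (P : ℝ))) = (1 : ℂ) := by
      rw [← fourier_neg, ← fourier_add]
      simp
    rw [one_mul] at h1 h2 h3
    simp only [g]
    rw [← h3, h2, show n + P + m = n + m + P by ring, h1, map_mul]
    linear_combination autocorr μ x n m * conj (fourierMode P r σ (n + m)) *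
      fourierMode P c σ n * h4
  have hs1 : ∀ n : ℤ, Summable fun m => g m n := fun n =>
    Summable.of_norm (by simpa only [hnorm] using (hsum n).norm)
  have hs2 : ∀ k : ℤ, Summable fun m => g m (k - m) := fun k => by
    refine Summable.of_norm ?_
    simp only [hnorm]
    refine ((Equiv.subLeft k).summable_iff.2 (summable_norm_autocorr_column hsum k)).congr
      fun m => ?_
    simp
  have hterm : cyclicPSDMatrix μ x P σ r c =
      (P : ℂ)⁻¹ * ∑ n ∈ Finset.range P, ∑' m : ℤ, g m n := by
    simp only [cyclicPSDMatrix, Matrix.of_apply, cyclicSpectrum, one_div]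
    congr 1
    refine Finset.sum_congr rfl fun n _ => tsum_congr fun m => ?_
    simp only [g]
    rw [conj_fourierMode, fourierMode, ← Complex.exp_add]
    congr 2
    push_cast
    ring
  rw [hterm, ← Summable.tsum_finsetSum fun (n : ℕ) _ => hs1 n]
  -- Starting the period at `-m` makes `n` the output time `k = n + m` of the operator; then `l = k
  -- - m` replaces the lag.
  have hshift : ∀ m, ∑ n ∈ Finset.range P, g m n = ∑ n ∈ Finset.range P, g m (n - m) := by
    intro m
    rw [← sum_range_add_of_periodic (hper m) (-m)]
    rfl
  simp only [hshift]
  rw [Summable.tsum_finsetSum fun (n : ℕ) _ => hs2 n]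
  congr 1
  refine Finset.sum_congr rfl fun k _ => ?_
  rw [← tsum_mul_left, ← (Equiv.subLeft (k : ℤ)).tsum_eq]
  refine tsum_congr fun l => ?_
  simp only [g, Equiv.subLeft_apply, sub_sub_cancel, add_sub_cancel]
  ring

/-- Expand `φ` in modes on both sides of the eigenequation and project on mode `r` over one period:
orthogonality isolates `b p r σ`. No unitarity is involved, hence every `σ` is allowed. -/
theorem IsKLBasis.cyclicPSDMatrix_mul_basisMatrix (hφ : IsKLBasis μ x φ S) (hb : HasCSForm P φ b)
    (hP : 0 < P) (hcs : IsCyclostationary μ x P)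
    (hsum : ∀ n : ℤ, Summable fun m : ℤ => autocorr μ x n m) {σ : ℝ}
    (hσ : σ ∈ Ico (0 : ℝ) (1 / P)) :
    cyclicPSDMatrix μ x P σ * basisMatrix P b σ = basisMatrix P b σ * klPSDMatrix P S σ := by
  have hPC : (P : ℂ) ≠ 0 := by exact_mod_cast hP.ne'
  ext r p
  have ht := add_div_mem_Ico_zero_one hσ p
  have hmode : ∀ (k : ℤ) (c : Fin P),
      Summable fun l : ℤ => autocorr μ x l (k - l) * fourierMode P c σ l := fun k c =>
    Summable.of_norm (by
      simpa only [norm_mul, norm_fourierMode, mul_one] using summable_norm_autocorr_column hsum k)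
  have heig : ∀ k : ℤ, ∑ c, b p c σ * ∑' l : ℤ, autocorr μ x l (k - l) * fourierMode P c σ l =
      S (σ + (p : ℝ) / P) * φ k (σ + (p : ℝ) / P) := by
    intro k
    rw [← (hφ.eigenequation _ ht k).tsum_eq]
    simp only [← tsum_mul_left]
    rw [← Summable.tsum_finsetSum fun c _ => (hmode k c).mul_left _]
    refine tsum_congr fun l => ?_
    rw [hb.eq_sum hσ, Finset.mul_sum]
    exact Finset.sum_congr rfl fun c _ => by ring
  rw [Matrix.mul_apply, klPSDMatrix, Matrix.mul_diagonal]
  simp only [cyclicPSDMatrix_apply_eq hP hcs hsum, basisMatrix, Matrix.of_apply]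
  calc ∑ c, (P : ℂ)⁻¹ * (∑ k ∈ Finset.range P, conj (fourierMode P r σ k) *
        ∑' l : ℤ, autocorr μ x l (k - l) * fourierMode P c σ l) * b p c σ
      = (P : ℂ)⁻¹ * ∑ k ∈ Finset.range P, conj (fourierMode P r σ k) *
        ∑ c, b p c σ * ∑' l : ℤ, autocorr μ x l (k - l) * fourierMode P c σ l := by
        simp only [Finset.mul_sum, Finset.sum_mul]
        rw [Finset.sum_comm]
        exact Finset.sum_congr rfl fun k _ => Finset.sum_congr rfl fun c _ => by ring
    _ = (P : ℂ)⁻¹ * ∑ k ∈ Finset.range P, ∑ q, S (σ + (p : ℝ) / P) * b p q σ *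
          (conj (fourierMode P r σ k) * fourierMode P q σ k) := by
        congr 1
        refine Finset.sum_congr rfl fun k _ => ?_
        rw [heig, hb.eq_sum hσ, Finset.mul_sum, Finset.mul_sum]
        exact Finset.sum_congr rfl fun c _ => by ring
    _ = b p r σ * S (σ + (p : ℝ) / P) := by
        rw [Finset.sum_comm]
        simp only [← Finset.mul_sum, sum_conj_fourierMode_mul hP]
        simp only [mul_ite, mul_zero, Finset.sum_ite_eq', Finset.mem_univ, if_true]
        field_simp

end KLBasis

/-! ### Mean-square convergence in `L²` -/

theorem inner_toLp_toLp {α : Type*} [MeasurableSpace α] {ν : Measure α} {f g : α → ℂ}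
    (hf : MemLp f 2 ν) (hg : MemLp g 2 ν) :
    inner ℂ (hf.toLp f) (hg.toLp g) = ∫ a, g a * conj (f a) ∂ν := by
  rw [L2.inner_def]
  refine integral_congr_ae ?_
  filter_upwards [hf.coeFn_toLp, hg.coeFn_toLp] with a h1 h2
  rw [h1, h2, RCLike.inner_apply]

theorem HasSum.inner_left {H ι : Type*} [NormedAddCommGroup H] [InnerProductSpace ℂ H]
    {f : ι → H} {a : H} (h : HasSum f a) (y : H) :
    HasSum (fun i => inner ℂ (f i) y) (inner ℂ a y) := by
  have h1 := (innerSL ℂ y).hasSum h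
  have h2 := h1.map (starRingEnd ℂ) Complex.continuous_conj
  simpa [Function.comp_def] using h2

theorem coeFn_sum_smul_toLp {α ι : Type*} [MeasurableSpace α] {ν : Measure α} {x : ι → α → ℂ}
    (hx : ∀ n, MemLp (x n) 2 ν) (c : ι → ℂ) (F : Finset ι) :
    ⇑(∑ n ∈ F, c n • (hx n).toLp (x n)) =ᵐ[ν] fun a => ∑ n ∈ F, x n a * c n := by
  classical
  induction F using Finset.induction_on with
  | empty => simpa using! Lp.coeFn_zero ℂ 2 ν
  | insert i F hi ih =>
    rw [Finset.sum_insert hi]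
    filter_upwards [Lp.coeFn_add (c i • (hx i).toLp (x i)) (∑ n ∈ F, c n • (hx n).toLp (x n)),
      Lp.coeFn_smul (c i) ((hx i).toLp (x i)), (hx i).coeFn_toLp, ih] with a h1 h2 h3 h4
    rw [h1, Pi.add_apply, h2, Pi.smul_apply, h3, h4, Finset.sum_insert hi, smul_eq_mul, mul_comm]

theorem tendsto_eLpNorm_sum_Ico_sub_iff {α : Type*} [MeasurableSpace α] {ν : Measure α}
    {x : ℤ → α → ℂ} (hx : ∀ n, MemLp (x n) 2 ν) (c : ℤ → ℂ) {y : α → ℂ} (hy : MemLp y 2 ν) :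
    Tendsto (fun M : ℕ => eLpNorm (fun a =>
        (∑ n ∈ Finset.Ico (-(M : ℤ)) (M : ℤ), x n a * c n) - y a) 2 ν) atTop (𝓝 0) ↔
      Tendsto (fun M : ℕ => ∑ n ∈ Finset.Ico (-(M : ℤ)) (M : ℤ), c n • (hx n).toLp (x n)) atTop
        (𝓝 (hy.toLp y)) := by
  have hmem : ∀ M : ℕ,
      MemLp (fun a => ∑ n ∈ Finset.Ico (-(M : ℤ)) (M : ℤ), x n a * c n) 2 ν := fun M =>
    memLp_finsetSum _ fun n _ => (hx n).mul_const (c n)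
  have heq : ∀ M : ℕ, (hmem M).toLp _ =
      ∑ n ∈ Finset.Ico (-(M : ℤ)) (M : ℤ), c n • (hx n).toLp (x n) := fun M =>
    Lp.ext ((hmem M).coeFn_toLp.trans (coeFn_sum_smul_toLp hx c _).symm)
  have := Lp.tendsto_Lp_iff_tendsto_eLpNorm'' (fi := (atTop : Filter ℕ)) _ hmem y hy
  simp only [heq] at this
  exact this.symm

/-! ### The KL spectrum, the KL transform and its covariance -/

section KLBasis

variable {Ω : Type*} [MeasurableSpace Ω] {μ : Measure Ω} {x : ℤ → Ω → ℂ} {P : ℕ}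
  {φ : ℤ → ℝ → ℂ} {S : ℝ → ℂ} {b : Fin P → Fin P → ℝ → ℂ}

theorem IsKLBasis.ae_sum_norm_sq_eq (hφ : IsKLBasis μ x φ S) (hb : HasCSForm P φ b) (hP : 0 < P) :
    ∀ᵐ t ∂volume.restrict (Ico (0 : ℝ) 1),
      (∑ k ∈ Finset.range P, conj (φ k t) * φ k t = P) ∧
        ∀ n w : ℤ, ‖φ (n + w * P) t‖ = ‖φ n t‖ := by
  rw [ae_restrict_Ico_zero_one_iff hP]
  intro p
  filter_upwards [hφ.ae_basisMatrix_mem_unitaryGroup hb hP, ae_restrict_mem measurableSet_Ico]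
    with σ h hσ
  refine ⟨hb.sum_norm_sq_eq hP hσ h p, fun n w => ?_⟩
  rw [hb.apply_add_mul hP hσ, norm_mul, fourier_apply, Circle.norm_coe, one_mul]

/-- For almost every `t`, `‖φ · t‖` is periodic and not identically zero, so it attains a positive
maximum at some `k`. The eigenequation at that `k` gives `‖S t‖ ‖φ k t‖ ≤ C ‖φ k t‖`. -/
theorem IsKLBasis.ae_norm_spectrum_le (hφ : IsKLBasis μ x φ S) (hb : HasCSForm P φ b)
    (hP : 0 < P) (hsum : ∀ n : ℤ, Summable fun m : ℤ => autocorr μ x n m) {C : ℝ}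
    (hC : ∀ k : ℤ, ∑' l : ℤ, ‖autocorr μ x l (k - l)‖ ≤ C) :
    ∀ᵐ t ∂volume.restrict (Ico (0 : ℝ) 1), ‖S t‖ ≤ C := by
  have hP' : (0 : ℤ) < P := by exact_mod_cast hP
  filter_upwards [hφ.ae_sum_norm_sq_eq hb hP, ae_restrict_mem measurableSet_Ico] with t ⟨h1, h2⟩ ht
  obtain ⟨k, -, hk⟩ := (Finset.range P).exists_max_image (fun k => ‖φ k t‖) ⟨0, by simpa using hP⟩
  have hmax : ∀ l : ℤ, ‖φ l t‖ ≤ ‖φ k t‖ := by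
    intro l
    have h3 := h2 (l % P) (l / P)
    rw [mul_comm, Int.emod_add_mul_ediv] at h3
    have h4 := Int.emod_lt_of_pos l hP'
    have h5 := Int.emod_nonneg l hP'.ne'
    have h6 := hk (l % P).toNat (Finset.mem_range.2 (by omega))
    rwa [Int.toNat_of_nonneg h5, ← h3] at h6
  have hpos : 0 < ‖φ k t‖ := by
    refine (norm_nonneg _).lt_of_ne fun h0 => ?_
    have : ∀ l : ℤ, φ l t = 0 := fun l => norm_le_zero_iff.1 (by rw [h0]; exact hmax l)
    simp only [this, mul_zero, Finset.sum_const_zero] at h1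
    exact hP.ne (by exact_mod_cast h1)
  have hrow := summable_norm_autocorr_column hsum (k : ℤ)
  have hle : ∀ l : ℤ, ‖autocorr μ x l (k - l) * φ l t‖ ≤ ‖autocorr μ x l (k - l)‖ * ‖φ k t‖ :=
    fun l => by rw [norm_mul]; exact mul_le_mul_of_nonneg_left (hmax l) (norm_nonneg _)
  have hfin : ‖S t‖ * ‖φ k t‖ ≤ C * ‖φ k t‖ := by
    rw [← norm_mul, ← (hφ.eigenequation t ht k).tsum_eq]
    refine (tsum_of_norm_bounded (hrow.mul_right _).hasSum hle).trans ?_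
    rw [tsum_mul_right]
    exact mul_le_mul_of_nonneg_right (hC k) hpos.le
  exact le_of_mul_le_mul_right hfin hpos

/-- Each `S * φ k` is a pointwise limit of measurable partial sums. Pairing with `conj (φ k)` over
one period, whose energy is `P`, recovers `S`. -/
theorem IsKLBasis.aestronglyMeasurable_spectrum (hφ : IsKLBasis μ x φ S) (hb : HasCSForm P φ b)
    (hP : 0 < P) : AEStronglyMeasurable S (volume.restrict (Ico (0 : ℝ) 1)) := by
  have hPC : (P : ℂ) ≠ 0 := by exact_mod_cast hP.ne'
  have h1 : ∀ k : ℤ,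
      AEStronglyMeasurable (fun t => S t * φ k t) (volume.restrict (Ico (0 : ℝ) 1)) := by
    intro k
    refine aestronglyMeasurable_of_tendsto_ae (atTop : Filter (Finset ℤ))
      (f := fun F t => ∑ l ∈ F, autocorr μ x l (k - l) * φ l t) (fun F => ?_) ?_
    · exact Finset.aestronglyMeasurable_fun_sum _ fun l _ =>
        (hφ.aestronglyMeasurable l).const_mul _
    · filter_upwards [ae_restrict_mem measurableSet_Ico] with t ht
      have := hφ.eigenequation t ht k
      rwa [HasSum, SummationFilter.unconditional_filter] at this
  have h2 : AEStronglyMeasurable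
      (fun t => (P : ℂ)⁻¹ * ∑ k ∈ Finset.range P, conj (φ k t) * (S t * φ k t))
      (volume.restrict (Ico (0 : ℝ) 1)) := by
    refine AEStronglyMeasurable.const_mul ?_ _
    refine Finset.aestronglyMeasurable_fun_sum _ fun k _ => ?_
    exact (Complex.continuous_conj.comp_aestronglyMeasurable
      (hφ.aestronglyMeasurable (k : ℤ))).mul (h1 (k : ℤ))
  refine h2.congr ?_
  filter_upwards [hφ.ae_sum_norm_sq_eq hb hP] with t ⟨h3, _⟩
  have : ∑ k ∈ Finset.range P, conj (φ k t) * (S t * φ k t) = S t * P := by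
    rw [← h3, Finset.mul_sum]
    exact Finset.sum_congr rfl fun k _ => by ring
  rw [this]
  field_simp

theorem IsKLBasis.memLp_spectrum (hφ : IsKLBasis μ x φ S) (hb : HasCSForm P φ b)
    (hP : 0 < P) (hcs : IsCyclostationary μ x P)
    (hsum : ∀ n : ℤ, Summable fun m : ℤ => autocorr μ x n m) :
    MemLp S 2 (volume.restrict (Ico (0 : ℝ) 1)) := by
  obtain ⟨C, -, hC⟩ := exists_bound_tsum_norm_autocorr hP hcs
  exact MemLp.of_bound (hφ.aestronglyMeasurable_spectrum hb hP) C
    (hφ.ae_norm_spectrum_le hb hP hsum hC)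

theorem restrict_restrict_of_subset_right {A s : Set ℝ} (h : A ⊆ s) (hA : MeasurableSet A) :
    (volume.restrict s).restrict A = volume.restrict A := by
  rw [Measure.restrict_restrict hA, inter_eq_left.2 h]

/-- Completeness with `B = A` is Parseval's equality for the indicator of `A`. -/
theorem IsKLBasis.hasSum_norm_sq (hφ : IsKLBasis μ x φ S) {A : Set ℝ} (hA : MeasurableSet A)
    (hA1 : A ⊆ Ico 0 1) :
    HasSum (fun n : ℤ => ‖∫ t in A, conj (φ n t)‖ ^ 2) (volume.real A) := by
  have h := hφ.complete A A hA hA hA1 hA1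
  rw [inter_self] at h
  rw [← Complex.hasSum_ofReal]
  refine h.congr_fun fun n => ?_
  rw [integral_conj, RCLike.norm_conj, ← Complex.normSq_eq_norm_sq, Complex.normSq_eq_conj_mul_self,
    mul_comm]

/-- Parseval's relation between an indicator function and a square-integrable function. -/
theorem IsKLBasis.hasSum_integral_mul (hφ : IsKLBasis μ x φ S) {A : Set ℝ} (hA : MeasurableSet A)
    (hA1 : A ⊆ Ico 0 1) {g : ℝ → ℂ} (hg : MemLp g 2 (volume.restrict (Ico (0 : ℝ) 1))) :
    HasSum (fun k : ℤ => (∫ t in A, conj (φ k t)) * ∫ t in Ico (0 : ℝ) 1, φ k t * g t)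
      (∫ t in A, g t) := by
  have hv : Orthonormal ℂ fun n => (hφ.memLp n).toLp (φ n) := by
    rw [orthonormal_iff_ite]
    intro i j
    rw [inner_toLp_toLp, hφ.orthonormal]
    simp [eq_comm]
  have h1 : MemLp (A.indicator fun _ => (1 : ℂ)) 2 (volume.restrict (Ico (0 : ℝ) 1)) :=
    (memLp_const 1).indicator hA
  have hind : ∀ f : ℝ → ℂ, ∫ t in Ico (0 : ℝ) 1, A.indicator (fun _ => (1 : ℂ)) t * f t =
      ∫ t in A, f t := by
    intro f
    rw [← restrict_restrict_of_subset_right hA1 hA, ← integral_indicator hA]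
    congr 1
    ext t
    by_cases ht : t ∈ A <;> simp [ht]
  have hin : ∀ n, inner ℂ ((hφ.memLp n).toLp (φ n)) (h1.toLp _) = ∫ t in A, conj (φ n t) := by
    intro n
    rw [inner_toLp_toLp, hind]
  have hnorm : ‖h1.toLp _‖ ^ 2 = volume.real A := by
    rw [← inner_self_eq_norm_sq (𝕜 := ℂ), inner_toLp_toLp, hind]
    have : ∫ t in A, conj (A.indicator (fun _ => (1 : ℂ)) t) = ∫ t in A, (1 : ℂ) :=
      setIntegral_congr_fun hA fun t ht => by simp [ht]
    rw [this]
    simp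
  -- Equality in Bessel makes the indicator the sum of its expansion; pairing it with `conj g`
  -- yields the claim, with no expansion of `g`.
  have hexp := hv.hasSum_inner_smul (x := h1.toLp _) (by
    simp only [hin]
    rw [hnorm]
    exact hφ.hasSum_norm_sq hA hA1)
  have h2 := (innerSL ℂ (hg.star.toLp _)).hasSum hexp
  simp only [innerSL_apply_apply, inner_smul_right, hin, inner_toLp_toLp] at h2
  simpa [hind] using h2

/-- From `‖φ‖ ≤ (1 + ‖φ‖ ^ 2) / 2`. The bound is uniform in `n`, which justifies integrating the
eigenequation termwise. -/
theorem IsKLBasis.integral_norm_le_one (hφ : IsKLBasis μ x φ S) (n : ℤ) :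
    ∫ t in Ico (0 : ℝ) 1, ‖φ n t‖ ≤ 1 := by
  have h1 : ∫ t in Ico (0 : ℝ) 1, ‖φ n t‖ ^ 2 = 1 := by
    have h2 := hφ.orthonormal n n
    rw [if_pos rfl] at h2
    have h3 : ∀ t, φ n t * conj (φ n t) = ((‖φ n t‖ ^ 2 : ℝ) : ℂ) := fun t => by
      rw [Complex.mul_conj, Complex.normSq_eq_norm_sq]
    simp only [h3] at h2
    rw [integral_complex_ofReal] at h2
    exact_mod_cast h2
  have h4 : Integrable (fun t => ‖φ n t‖ ^ 2) (volume.restrict (Ico (0 : ℝ) 1)) :=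
    (memLp_two_iff_integrable_sq_norm (hφ.aestronglyMeasurable n)).1 (hφ.memLp n)
  calc ∫ t in Ico (0 : ℝ) 1, ‖φ n t‖ ≤ ∫ t in Ico (0 : ℝ) 1, (1 / 2 + ‖φ n t‖ ^ 2 * (1 / 2)) := by
        refine integral_mono ((hφ.memLp n).integrable (by norm_num)).norm
          ((integrable_const _).add (h4.mul_const _)) fun t => ?_
        simp only
        nlinarith [sq_nonneg (‖φ n t‖ - 1)]
    _ = 1 := by
        rw [integral_add (integrable_const _) (h4.mul_const _), integral_mul_const, h1]
        simp
        norm_num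

theorem IsKLBasis.hasSum_autocorr_mul_integral (hφ : IsKLBasis μ x φ S)
    (hsum : ∀ n : ℤ, Summable fun m : ℤ => autocorr μ x n m) {B : Set ℝ} (hB : MeasurableSet B)
    (hB1 : B ⊆ Ico 0 1) (k : ℤ) :
    HasSum (fun l : ℤ => autocorr μ x l (k - l) * ∫ t in B, φ l t) (∫ t in B, S t * φ k t) := by
  have hint : ∀ l, IntegrableOn (φ l) (Ico (0 : ℝ) 1) := fun l =>
    (hφ.memLp l).integrable (by norm_num)
  have h := hasSum_integral_of_summable_integral_norm (μ := volume.restrict B)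
    (F := fun l t => autocorr μ x l (k - l) * φ l t)
    (fun l => ((hint l).mono_set hB1).const_mul _) (by
      refine Summable.of_nonneg_of_le (fun l => integral_nonneg fun t => norm_nonneg _)
        (fun l => ?_) (summable_norm_autocorr_column hsum k)
      simp only [norm_mul]
      rw [integral_const_mul]
      refine mul_le_of_le_one_right (norm_nonneg _) (le_trans ?_ (hφ.integral_norm_le_one l))
      exact setIntegral_mono_set (hint l).norm (Eventually.of_forall fun t => norm_nonneg _)
        hB1.eventuallyLE)
  simp only [integral_const_mul] at h
  rwa [setIntegral_congr_fun hB fun t ht => (hφ.eigenequation t (hB1 ht) k).tsum_eq] at h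

theorem IsKLBasis.summable_smul_toLp (hφ : IsKLBasis μ x φ S) (hP : 0 < P)
    (hx : ∀ n, MemLp (x n) 2 μ) (hcs : IsCyclostationary μ x P)
    (hsum : ∀ n : ℤ, Summable fun m : ℤ => autocorr μ x n m) {A : Set ℝ} (hA : MeasurableSet A)
    (hA1 : A ⊆ Ico 0 1) :
    Summable fun n : ℤ => (∫ t in A, conj (φ n t)) • (hx n).toLp (x n) := by
  obtain ⟨C, -, hC⟩ := exists_bound_tsum_norm_autocorr hP hcs
  exact summable_smul_of_gram_bound (sum_norm_inner_toLp_le hx hsum hC)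
    (hφ.hasSum_norm_sq hA hA1).summable

theorem tendsto_sum_Ico_neg {H : Type*} [AddCommMonoid H] [TopologicalSpace H] {f : ℤ → H} {a : H}
    (h : HasSum f a) :
    Tendsto (fun M : ℕ => ∑ n ∈ Finset.Ico (-(M : ℤ)) (M : ℤ), f n) atTop (𝓝 a) := by
  rw [HasSum, SummationFilter.unconditional_filter] at h
  exact h.comp Finset.tendsto_Ico_neg

theorem IsKLBasis.exists_isKLTransform (hφ : IsKLBasis μ x φ S) (hP : 0 < P)
    (hx : ∀ n, MemLp (x n) 2 μ) (hcs : IsCyclostationary μ x P)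
    (hsum : ∀ n : ℤ, Summable fun m : ℤ => autocorr μ x n m) :
    ∃ ξ : Set ℝ → Ω → ℂ, IsKLTransform μ x φ ξ := by
  refine ⟨fun A => (∑' n : ℤ, (∫ t in A, conj (φ n t)) • (hx n).toLp (x n) : Lp ℂ 2 μ),
    fun A hA hA1 => ⟨Lp.memLp _, ?_⟩⟩
  rw [tendsto_eLpNorm_sum_Ico_sub_iff hx _ (Lp.memLp _), Lp.toLp_coeFn]
  exact tendsto_sum_Ico_neg (hφ.summable_smul_toLp hP hx hcs hsum hA hA1).hasSum

theorem IsKLBasis.integral_klTransform_mul_conj (hφ : IsKLBasis μ x φ S) (hb : HasCSForm P φ b)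
    (hP : 0 < P) (hx : ∀ n, MemLp (x n) 2 μ) (hcs : IsCyclostationary μ x P)
    (hsum : ∀ n : ℤ, Summable fun m : ℤ => autocorr μ x n m) {ξ : Set ℝ → Ω → ℂ}
    (hξ : IsKLTransform μ x φ ξ) {A B : Set ℝ} (hA : MeasurableSet A) (hB : MeasurableSet B)
    (hA1 : A ⊆ Ico 0 1) (hB1 : B ⊆ Ico 0 1) :
    ∫ ω, ξ A ω * conj (ξ B ω) ∂μ = ∫ t in A ∩ B, S t := by
  -- `IsKLTransform` speaks only of symmetric partial sums; since the series is summable, uniqueness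
  -- of limits makes `ξ D` its unconditional sum.
  have hξsum : ∀ D : Set ℝ, ∀ hD : MeasurableSet D, ∀ hD1 : D ⊆ Ico 0 1,
      HasSum (fun n : ℤ => (∫ t in D, conj (φ n t)) • (hx n).toLp (x n))
        ((hξ D hD hD1).1.toLp (ξ D)) := by
    intro D hD hD1
    have h1 := (hφ.summable_smul_toLp hP hx hcs hsum hD hD1).hasSum
    have h2 := (tendsto_eLpNorm_sum_Ico_sub_iff hx _ (hξ D hD hD1).1).1 (hξ D hD hD1).2
    rwa [tendsto_nhds_unique (tendsto_sum_Ico_neg h1) h2] at h1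
  -- Expanding `ξ B` produces the autocorrelation operator applied to `∫_B φ`, which the integrated
  -- eigenequation evaluates.
  have hcross : ∀ k : ℤ, inner ℂ ((hξ B hB hB1).1.toLp (ξ B)) ((hx k).toLp (x k)) =
      ∫ t in Ico (0 : ℝ) 1, φ k t * B.indicator S t := by
    intro k
    have h1 := (hξsum B hB hB1).inner_left ((hx k).toLp (x k))
    simp only [inner_smul_left, inner_toLp_eq_autocorr, integral_conj, Complex.conj_conj] at h1
    have h2 := hφ.hasSum_autocorr_mul_integral hsum hB hB1 k
    simp only [mul_comm (autocorr _ _ _ _)] at h2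
    rw [h1.unique h2, ← restrict_restrict_of_subset_right hB1 hB, ← integral_indicator hB]
    congr 1
    ext t
    by_cases ht : t ∈ B <;> simp [ht, mul_comm]
  have h1 := (innerSL ℂ ((hξ B hB hB1).1.toLp (ξ B))).hasSum (hξsum A hA hA1)
  simp only [innerSL_apply_apply, inner_smul_right, hcross,
    inner_toLp_toLp] at h1
  have h2 := hφ.hasSum_integral_mul hA hA1 ((hφ.memLp_spectrum hb hP hcs hsum).indicator hB)
  rw [h1.unique h2, setIntegral_indicator hB]

end KLBasis

/-! ### Average power -/

/-- The symmetric Cesàro means of a periodic sequence converge to its mean over a period. -/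
theorem tendsto_average_Ico_of_periodic {P : ℕ} (hP : 0 < P) {a : ℤ → ℝ}
    (ha : Function.Periodic a P) :
    Tendsto (fun M : ℕ => (1 / (2 * (M : ℝ))) * ∑ n ∈ Finset.Ico (-(M : ℤ)) (M : ℤ), a n) atTop
      (𝓝 ((1 / (P : ℝ)) * ∑ n ∈ Finset.range P, a n)) := by
  have hPR : (P : ℝ) ≠ 0 := by exact_mod_cast hP.ne'
  set c : ℝ := (1 / (P : ℝ)) * ∑ n ∈ Finset.range P, a n with hc
  -- The window `[-M, M)` is the union of the pairs `{n, -1 - n}` with `0 ≤ n < M`; `u` is the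
  -- excess of a pair over the mean.
  let u : ℕ → ℝ := fun n => (a n - c) + (a (-1 - n) - c)
  have hT : ∀ M : ℕ, ∑ n ∈ Finset.Ico (-(M : ℤ)) (M : ℤ), a n =
      ∑ n ∈ Finset.range M, u n + 2 * M * c := by
    intro M
    induction M with
    | zero => simp
    | succ M ih =>
      have h1 : Finset.Ico (-((M + 1 : ℕ) : ℤ)) ((M + 1 : ℕ) : ℤ) =
          insert (M : ℤ) (insert (-1 - (M : ℤ)) (Finset.Ico (-(M : ℤ)) (M : ℤ))) := by
        ext n
        simp only [Finset.mem_Ico, Finset.mem_insert]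
        omega
      rw [h1, Finset.sum_insert (by simp only [Finset.mem_Ico, Finset.mem_insert]; omega),
        Finset.sum_insert (by simp only [Finset.mem_Ico]; omega), ih, Finset.sum_range_succ]
      simp only [u]
      push_cast
      ring
  -- A full period of `u` sums to zero, so its partial sums are periodic, hence bounded, and the
  -- factor `1 / (2M)` kills them.
  have hu : Function.Periodic (fun M : ℕ => ∑ n ∈ Finset.range M, u n) P := by
    intro M
    have h1 : ∑ n ∈ Finset.range P, a (n + M) = P * c := by
      rw [sum_range_add_of_periodic ha, hc]
      field_simp
    have h2 : ∑ n ∈ Finset.range P, a (-1 - (n + M)) = P * c := by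
      have h3 := sum_range_add_of_periodic ha (-(M : ℤ) - P)
      rw [← Finset.sum_range_reflect] at h3
      have h4 : ∑ n ∈ Finset.range P, a n = P * c := by rw [hc]; field_simp
      rw [← h4, ← h3]
      refine Finset.sum_congr rfl fun n hn => ?_
      have := Finset.mem_range.1 hn
      congr 1
      omega
    simp only
    rw [add_comm M P, add_comm P M, Finset.sum_range_add]
    simp only [u, Finset.sum_add_distrib, Finset.sum_sub_distrib]
    have h1' : ∑ n ∈ Finset.range P, a ((M + n : ℕ) : ℤ) = P * c := by
      rw [← h1]
      exact Finset.sum_congr rfl fun n _ => by congr 1; push_cast; ring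
    have h2' : ∑ n ∈ Finset.range P, a (-1 - ((M + n : ℕ) : ℤ)) = P * c := by
      rw [← h2]
      exact Finset.sum_congr rfl fun n _ => by congr 1; push_cast; ring
    rw [h1', h2']
    simp
  have hbdd : ∀ M : ℕ, ‖∑ n ∈ Finset.range M, u n‖ ≤
      ∑ i ∈ Finset.range P, ‖∑ n ∈ Finset.range i, u n‖ := by
    intro M
    rw [← hu.map_mod_nat M]
    exact Finset.single_le_sum (f := fun i => ‖∑ n ∈ Finset.range i, u n‖)
      (fun _ _ => norm_nonneg _) (Finset.mem_range.2 (Nat.mod_lt _ hP))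
  have hinv : Tendsto (fun M : ℕ => 1 / (2 * (M : ℝ))) atTop (𝓝 0) := by
    have := (tendsto_const_div_atTop_nhds_zero_nat (1 / 2 : ℝ))
    refine this.congr fun M => ?_
    rw [div_div]
  have h0 : Tendsto (fun M : ℕ => (1 / (2 * (M : ℝ))) * ∑ n ∈ Finset.range M, u n) atTop (𝓝 0) :=
    hinv.zero_mul_isBoundedUnder_le (isBoundedUnder_of ⟨_, hbdd⟩)
  have h1 := h0.add_const c
  rw [zero_add] at h1
  refine h1.congr' ?_
  filter_upwards [eventually_gt_atTop 0] with M hM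
  have hMR : (M : ℝ) ≠ 0 := by exact_mod_cast hM.ne'
  rw [hT]
  field_simp

section Power

variable {Ω : Type*} [MeasurableSpace Ω] {μ : Measure Ω} {x : ℤ → Ω → ℂ} {P : ℕ}

theorem ofReal_integral_norm_sq_eq_autocorr (n : ℤ) :
    ((∫ ω, ‖x n ω‖ ^ 2 ∂μ : ℝ) : ℂ) = autocorr μ x n 0 := by
  rw [autocorr, ← integral_complex_ofReal]
  congr 1
  ext ω
  rw [add_zero, Complex.mul_conj, Complex.normSq_eq_norm_sq]

theorem IsCyclostationary.hasAveragePower (hcs : IsCyclostationary μ x P) (hP : 0 < P) :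
    HasAveragePower μ x ((1 / (P : ℝ)) * ∑ n ∈ Finset.range P, ∫ ω, ‖x n ω‖ ^ 2 ∂μ) := by
  refine tendsto_average_Ico_of_periodic hP (a := fun n : ℤ => ∫ ω, ‖x n ω‖ ^ 2 ∂μ) fun n => ?_
  have h := hcs n 0 1
  rw [← ofReal_integral_norm_sq_eq_autocorr, ← ofReal_integral_norm_sq_eq_autocorr, one_mul] at h
  exact_mod_cast h.symm

theorem continuous_cyclicSpectrum (hsum : ∀ n : ℤ, Summable fun m : ℤ => autocorr μ x n m)
    (k : ℤ) : Continuous (cyclicSpectrum μ x P k) := by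
  refine continuous_const.mul (continuous_finsetSum _ fun n _ => ?_)
  refine continuous_tsum (fun m => by fun_prop) (hsum n).norm fun m f => ?_
  rw [norm_mul, Complex.norm_exp]
  simp [← Complex.ofReal_intCast, ← Complex.ofReal_natCast, ← Complex.ofReal_mul,
    ← Complex.ofReal_div, ← Complex.ofReal_add]

/-- Termwise integration over a full period of frequencies annihilates every nonzero lag. -/
theorem integral_cyclicSpectrum_zero (hsum : ∀ n : ℤ, Summable fun m : ℤ => autocorr μ x n m) :
    ∫ f in Ico (0 : ℝ) 1, cyclicSpectrum μ x P 0 f =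
      (1 / (P : ℂ)) * ∑ n ∈ Finset.range P, autocorr μ x n 0 := by
  have hterm : ∀ (n : ℕ) (m : ℤ) (f : ℝ), autocorr μ x n m * Complex.exp
        (-(Complex.I * (2 * Real.pi * (((0 : ℤ) : ℂ) * n / P + f * m)))) =
      autocorr μ x n m * Complex.exp
        (2 * Real.pi * Complex.I * ((-m : ℤ) : ℂ) * f / ((1 : ℝ) : ℂ)) := by
    intro n m f
    congr 2
    push_cast
    ring
  have hnorm : ∀ (n : ℕ) (m : ℤ) (f : ℝ), ‖autocorr μ x n m * Complex.exp
      (2 * Real.pi * Complex.I * ((-m : ℤ) : ℂ) * f / ((1 : ℝ) : ℂ))‖ = ‖autocorr μ x n m‖ := by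
    intro n m f
    have : 2 * Real.pi * Complex.I * ((-m : ℤ) : ℂ) * f / ((1 : ℝ) : ℂ) =
        ((2 * Real.pi * (-m : ℤ) * f : ℝ) : ℂ) * Complex.I := by
      push_cast
      ring
    rw [norm_mul, this, Complex.norm_exp_ofReal_mul_I, mul_one]
  have hint : ∀ (n : ℕ) (m : ℤ), Integrable (fun f : ℝ => autocorr μ x n m * Complex.exp
      (2 * Real.pi * Complex.I * ((-m : ℤ) : ℂ) * f / ((1 : ℝ) : ℂ)))
      (volume.restrict (Ico (0 : ℝ) 1)) := by
    intro n m
    refine Integrable.const_mul ?_ _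
    refine (Continuous.integrableOn_Icc (a := 0) (b := 1) ?_).mono_set Ico_subset_Icc_self
    fun_prop
  have hsumn : ∀ n : ℕ, Summable fun m : ℤ => ∫ f in Ico (0 : ℝ) 1, ‖autocorr μ x n m *
      Complex.exp (2 * Real.pi * Complex.I * ((-m : ℤ) : ℂ) * f / ((1 : ℝ) : ℂ))‖ := by
    intro n
    simp only [hnorm]
    simpa using (hsum n).norm
  simp only [cyclicSpectrum, hterm]
  rw [integral_const_mul, integral_finsetSum]
  · congr 1
    refine Finset.sum_congr rfl fun n _ => ?_
    rw [← integral_tsum_of_summable_integral_norm (hint n) (hsumn n)]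
    simp only [integral_const_mul, integral_Ico_exp_int one_pos]
    rw [tsum_eq_single 0]
    · simp
    · intro m hm
      simp [hm]
  · intro n _
    have hcont : Continuous fun f : ℝ => ∑' m : ℤ, autocorr μ x n m * Complex.exp
        (2 * Real.pi * Complex.I * ((-m : ℤ) : ℂ) * f / ((1 : ℝ) : ℂ)) :=
      continuous_tsum (fun m => by fun_prop) (hsum n).norm fun m f => (hnorm n m f).le
    exact (hcont.integrableOn_Icc (a := 0) (b := 1)).mono_set Ico_subset_Icc_self

theorem trace_cyclicPSDMatrix (σ : ℝ) : (cyclicPSDMatrix μ x P σ).trace =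
    ∑ r : Fin P, cyclicSpectrum μ x P 0 (σ + (r : ℝ) / P) := by
  simp [Matrix.trace, cyclicPSDMatrix]

theorem integrableOn_trace_cyclicPSDMatrix
    (hsum : ∀ n : ℤ, Summable fun m : ℤ => autocorr μ x n m) :
    IntegrableOn (fun σ => (cyclicPSDMatrix μ x P σ).trace) (Ico (0 : ℝ) (1 / P)) := by
  simp only [trace_cyclicPSDMatrix]
  refine (Continuous.integrableOn_Icc (a := 0) (b := 1 / (P : ℝ)) ?_).mono_set Ico_subset_Icc_self
  have := continuous_cyclicSpectrum (P := P) hsum 0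
  fun_prop

theorem integral_trace_cyclicPSDMatrix (hP : 0 < P)
    (hsum : ∀ n : ℤ, Summable fun m : ℤ => autocorr μ x n m) :
    (((1 / (P : ℝ)) * ∑ n ∈ Finset.range P, ∫ ω, ‖x n ω‖ ^ 2 ∂μ : ℝ) : ℂ) =
      ∫ σ in Ico (0 : ℝ) (1 / P), (cyclicPSDMatrix μ x P σ).trace := by
  simp only [trace_cyclicPSDMatrix]
  rw [← integral_Ico_zero_one_eq_sum hP, integral_cyclicSpectrum_zero hsum]
  · simp only [← ofReal_integral_norm_sq_eq_autocorr]
    push_cast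
    rfl
  · exact ((continuous_cyclicSpectrum hsum 0).integrableOn_Icc (a := 0) (b := 1)).mono_set
      Ico_subset_Icc_self

end Power

/-! ### Assembling the corollary -/

theorem image_add_subset_Ico_zero_one {P : ℕ} {A : Set ℝ} (hA : A ⊆ Ico (0 : ℝ) (1 / P))
    (p : Fin P) : (fun σ : ℝ => σ + (p : ℝ) / P) '' A ⊆ Ico 0 1 := by
  rintro _ ⟨σ, hσ, rfl⟩
  exact add_div_mem_Ico_zero_one (hA hσ) p

theorem disjoint_image_add {P : ℕ} {A B : Set ℝ} (hA : A ⊆ Ico (0 : ℝ) (1 / P))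
    (hB : B ⊆ Ico (0 : ℝ) (1 / P)) {p q : Fin P} (hpq : p ≠ q) :
    Disjoint ((fun σ : ℝ => σ + (p : ℝ) / P) '' A) ((fun σ : ℝ => σ + (q : ℝ) / P) '' B) := by
  rw [Set.disjoint_left]
  rintro _ ⟨σ, hσ, rfl⟩ ⟨τ, hτ, h⟩
  have hP' : (0 : ℝ) < P := by exact_mod_cast p.pos
  have h1 := hA hσ
  have h2 := hB hτ
  have h3 : σ * P < 1 := (lt_div_iff₀ hP').1 h1.2
  have h4 : τ * P < 1 := (lt_div_iff₀ hP').1 h2.2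
  have h5 : 0 ≤ σ * P := mul_nonneg h1.1 hP'.le
  have h6 : 0 ≤ τ * P := mul_nonneg h2.1 hP'.le
  have h7 : τ * P + (q : ℕ) = σ * P + (p : ℕ) := by
    have := congrArg (· * (P : ℝ)) h
    simpa [add_mul, hP'.ne'] using this
  have h8 : ((p : ℕ) : ℝ) < (q : ℕ) + 1 := by linarith
  have h9 : ((q : ℕ) : ℝ) < (p : ℕ) + 1 := by linarith
  norm_cast at h8 h9
  exact hpq (Fin.ext (by omega))

theorem corollary2 {Ω : Type*} [MeasurableSpace Ω] (μ : Measure Ω) [IsProbabilityMeasure μ]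
    (P : ℕ) (hP : 0 < P) (x : ℤ → Ω → ℂ)
    (hx : ∀ n, MemLp (x n) 2 μ)
    (hcs : IsCyclostationary μ x P)
    (hsum : ∀ n : ℤ, Summable fun m : ℤ => autocorr μ x n m) :
    -- the KL-PSD matrix, for every KL basis of cyclostationary form
    (∀ (φ : ℤ → ℝ → ℂ) (S : ℝ → ℂ) (b : Fin P → Fin P → ℝ → ℂ),
      IsKLBasis μ x φ S → HasCSForm P φ b →
      -- the basis matrix is unitary for almost all `σ`; wherever it is, the diagonal of the
      -- KL-PSD matrix is the list of the `P` eigenvalues of the cyclic PSD matrix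
      (∀ᵐ σ ∂(volume.restrict (Ico (0 : ℝ) (1 / P))),
        basisMatrix P b σ ∈ Matrix.unitaryGroup (Fin P) ℂ) ∧
      (∀ σ ∈ Ico (0 : ℝ) (1 / P), basisMatrix P b σ ∈ Matrix.unitaryGroup (Fin P) ℂ →
        (cyclicPSDMatrix μ x P σ).charpoly.roots =
          Finset.univ.val.map (fun p : Fin P => klPSDMatrix P S σ p p)) ∧
      -- the KL transform exists, and `E[x̃ x̃ᴴ]` has the KL-PSD matrix as its density
      (∃ ξ : Set ℝ → Ω → ℂ, IsKLTransform μ x φ ξ) ∧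
      (∀ p q : Fin P, IntegrableOn (fun σ => klPSDMatrix P S σ p q) (Ico (0 : ℝ) (1 / P))) ∧
      (∀ ξ : Set ℝ → Ω → ℂ, IsKLTransform μ x φ ξ →
        ∀ A B : Set ℝ, MeasurableSet A → MeasurableSet B →
          A ⊆ Ico (0 : ℝ) (1 / P) → B ⊆ Ico (0 : ℝ) (1 / P) →
          ∀ p q : Fin P,
            ∫ ω, klVector P ξ A ω p * conj (klVector P ξ B ω q) ∂μ =
              ∫ σ in A ∩ B, klPSDMatrix P S σ p q) ∧
      ∃ power : ℝ, HasAveragePower μ x power ∧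
        (power : ℂ) = ∫ σ in Ico (0 : ℝ) (1 / P), (klPSDMatrix P S σ).trace) ∧
    -- the power of the process
    IntegrableOn (fun σ => (cyclicPSDMatrix μ x P σ).trace) (Ico (0 : ℝ) (1 / P)) ∧
    ∃ power : ℝ, HasAveragePower μ x power ∧
      (power : ℂ) = ∫ σ in Ico (0 : ℝ) (1 / P), (cyclicPSDMatrix μ x P σ).trace := by
  refine ⟨fun φ S b hφ hb => ?_, integrableOn_trace_cyclicPSDMatrix hsum, _,
    hcs.hasAveragePower hP, integral_trace_cyclicPSDMatrix hP hsum⟩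
  have hmul : ∀ σ ∈ Ico (0 : ℝ) (1 / P), cyclicPSDMatrix μ x P σ * basisMatrix P b σ =
      basisMatrix P b σ * klPSDMatrix P S σ := fun σ hσ =>
    hφ.cyclicPSDMatrix_mul_basisMatrix hb hP hcs hsum hσ
  have hunitary := hφ.ae_basisMatrix_mem_unitaryGroup hb hP
  have hS : IntegrableOn S (Ico (0 : ℝ) 1) :=
    (hφ.memLp_spectrum hb hP hcs hsum).integrable (by norm_num)
  refine ⟨hunitary, fun σ hσ hU => ?_, hφ.exists_isKLTransform hP hx hcs hsum, fun p q => ?_,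
    fun ξ hξ A B hA hB hA1 hB1 p q => ?_, _, hcs.hasAveragePower hP, ?_⟩
  · rw [charpoly_roots_of_mul_eq_mul_diagonal hU (hmul σ hσ)]
    simp [klPSDMatrix]
  · rcases eq_or_ne p q with rfl | hpq
    · simpa [klPSDMatrix] using (integrableOn_Ico_zero_one_iff hP).1 hS p
    · simp [klPSDMatrix, hpq]
  · have hemb : ∀ p : Fin P, MeasurableEmbedding fun σ : ℝ => σ + (p : ℝ) / P := fun p =>
      measurableEmbedding_addRight _
    simp only [klVector]
    rw [hφ.integral_klTransform_mul_conj hb hP hx hcs hsum hξ ((hemb p).measurableSet_image.2 hA)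
      ((hemb q).measurableSet_image.2 hB) (image_add_subset_Ico_zero_one hA1 p)
      (image_add_subset_Ico_zero_one hB1 q)]
    -- On the diagonal, translation by `p/P` brings the integral back to `A ∩ B`; off it, the
    -- sub-bands are disjoint and the integral is `0`.
    rcases eq_or_ne p q with rfl | hpq
    · rw [← image_inter (hemb p).injective,
        (measurePreserving_add_right volume ((p : ℝ) / P)).setIntegral_image_emb (hemb p)]
      simp [klPSDMatrix]
    · rw [(disjoint_image_add hA1 hB1 hpq).inter_eq]
      simp [klPSDMatrix, hpq]
  · rw [integral_trace_cyclicPSDMatrix hP hsum]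
    refine integral_congr_ae ?_
    filter_upwards [hunitary, ae_restrict_mem measurableSet_Ico] with σ hU hσ
    exact trace_of_mul_eq_mul_diagonal hU (hmul σ hσ)
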